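/- **Proposition ($N$-positon solution).** Let $N\ge 1$ and let $\lambda_1,\lambda_2\in\mathbb C\setminus\{0\}$. For $1\le i\le 2N$, $\lambda\neq0$ and $X,T\in\mathbb C$ put $$\phi(\lambda)=e^{-\frac{iX}{2\lambda}-i\lambda T},\qquad \psi_i(\lambda)=s_i\,e^{\frac{iX}{2\lambda}+i\lambda T},\qquad s_i=1\ (i\text{ odd}),\quad s_i=-1\ (i\text{ even})$$ (here $\phi$, $\psi_i$ depend on $X,T$ and $i$ in the exponents is the imaginary unit). For eigenvalues $\lambda_1,\dots,\lambda_{2N}$ let $W_N$ be the $2N\times 2N$ matrix whose $i$-th row is $(\phi,\psi_i,\lambda\phi,\lambda\psi_i,\dots,\lambda^{N-1}\phi,\lambda^{N-1}\psi_i)$ at $\lambda=\lambda_i$. Let $\Delta_{11}$, $\Delta_{12}$, $\Delta_{21}$ be minus the determinant of the matrix obtained from $W_N$ by replacing, respectively, column $2N-1$ by $(\lambda_i^N\phi(\lambda_i))_i$, column $2N$ by $(\lambda_i^N\phi(\lambda_i))_i$, column $2N-1$ by $(\lambda_i^N\psi_i(\lambda_i))_i$. The $N$-soliton formulas over the zero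 seed are $$q^{[N]}=2i\frac{\Delta_{12}}{|W_N|},\qquad r^{[N]}=-2i\frac{\Delta_{21}}{|W_N|},\qquad x^{[N]}=X+2i\frac{\Delta_{11}}{|W_N|}.$$ Let $W'_N,\Delta'_{11},\Delta'_{12},\Delta'_{21}$ be obtained by replacing each entry $e_{ij}(\lambda_i)$ of row $i$ by $\partial_\epsilon^{\lfloor (i-1)/2\rfloor}e_{ij}(\lambda_k+\epsilon)|_{\epsilon=0}$, where $k=1$ for odd $i$ and $k=2$ for even $i$, and put $$q_p^{[N]}=2i\frac{\Delta'_{12}}{|W'_N|},\qquad r_p^{[N]}=-2i\frac{\Delta'_{21}}{|W'_N|},\qquad x_p^{[N]}=X+2i\frac{\Delta'_{11}}{|W'_N|}.$$ Let $D=\{(X,T)\in\mathbb C^2:|W'_N|(X,T)\ne0\}$. Then: 1. $(0,0)\in D$. 2. (Degenerate limit.) At every point of $D$, as $(\lambda_1',\dots,\lambda_{2N}')\to(\lambda_1,\lambda_2,\lambda_1,\lambda_2,\dots,\lambda_1,\lambda_2)$ through tuples of pairwise distinct eigenvalues, $|W_N|$ is eventually non-zero and $q^{[N]},r^{[N]},x^{[N]}$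 (with eigenvalues $\lambda'_i$) tend to $q_p^{[N]},r_p^{[N]},x_p^{[N]}$. 3. (Solution in the $(X,T)$-plane.) $D$ is open and symmetric under $(X,T)\mapsto(-X,-T)$, and $u=q_p^{[N]}$, $v=r_p^{[N]}$, $x=x_p^{[N]}$, $\rho=x_X$ are smooth (holomorphic) on $D$ and satisfy there $u_{XT}=-2u\rho$, $\rho_T=-(uv)_X$, $v(X,T)=-u(-X,-T)$, $\rho^2-u_Xv_X=1$ and $dx=\rho\,dX-uv\,dT$. 4. (Solution in the $(x,t)$-plane.) The hodograph coordinate is determined up to an additive constant; put $x=x_p^{[N]}+iN(\lambda_1+\lambda_2)$ and $t=-T$. Let $O\subset D$ be open, symmetric under $(X,T)\mapsto(-X,-T)$, with $x_X\ne0$ on $O$ and $h:(X,T)\mapsto(x(X,T),-T)$ injective on $O$, and let $q$ be the function of $(x,t)\in h(O)$ with $q\circ h=q_p^{[N]}$. Then $h(O)$ is open and symmetric under $(x,t)\mapsto(-x,-t)$, $q$ is smooth on $h(O)$, and $$q_{xt}(x,t)-2q(x,t)-\big(q(x,t)\,q(-x,-t)\,q_x(x,t)\big)_x=0 ,$$ while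 $r(x,t)=-q(-x,-t)$ satisfies $r\circ h=r_p^{[N]}$. This holds with complex variables $X,T,x,t$. If $\lambda_1=i\alpha_1$, $\lambda_2=i\alpha_2$ with $\alpha_1,\alpha_2$ real, then $x$ is real for real $X,T$, and the same holds with real variables $X,T,x,t$. 5. (The 2-positon.) Let $N=2$, $\lambda_1=i\alpha_1$, $\lambda_2=i\alpha_2$, and put $H_k=(2T\alpha_k^2-X)/\alpha_k$, $S_k=2T\alpha_k^2+X$, $\delta=\alpha_1-\alpha_2$, $$A_1=2\delta\alpha_1^2\,(2\alpha_2^2-\delta S_2)\,e^{H_1},\qquad A_2=2\delta\alpha_2^2\,(2\alpha_1^2+\delta S_1)\,e^{H_2},\qquad A_4=2\alpha_1^2\alpha_2^2+\delta^2S_1S_2,$$ $$A_3=XA_4+4(\alpha_1+\alpha_2)\alpha_1^2\alpha_2^2+2\delta^2(\alpha_2^2S_1+\alpha_1^2S_2)+2\delta^2(\alpha_1+\alpha_2)S_1S_2 .$$ Then on $D$ the denominators below are non-zero and $$q_p^{[2]}=\frac{A_1+A_2}{2\alpha_1^2\alpha_2^2\cosh(H_1-H_2)+A_4},$$ $$x_p^{[2]}=\frac{2\alpha_1^2\alpha_2^2\big[(2\alpha_1+2\alpha_2+X)\cosh(H_1-H_2)+2(\alpha_1-\alpha_2)\sinh(H_1-H_2)\big]+A_3}{2\alpha_1^2\alpha_2^2\cosh(H_1-H_2)+A_4}.$$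 -/

import Mathlib

open scoped ContDiff Topology

noncomputable section

namespace RSTPositon

/-! ## The determinants

Rows and columns are counted from `0`, so row `i` of the code is row `i + 1` of the usual
numbering: even `i` belongs to `λ₁`, odd `i` to `λ₂`. -/

/-- First component of the zero-seed eigenfunction for the eigenvalue `l`. -/
def phi (X T l : ℂ) : ℂ :=
  Complex.exp (-(Complex.I * X / (2 * l)) - Complex.I * l * T)

/-- Second component of the zero-seed eigenfunction used in row `i`. The sign implements the
nonlocal reduction `φ(X,T) = ψ(-X,-T)` (even `i`), `φ(X,T) = -ψ(-X,-T)` (odd `i`). -/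
def psi (i : ℕ) (X T l : ℂ) : ℂ :=
  (if Even i then 1 else -1) * Complex.exp (Complex.I * X / (2 * l) + Complex.I * l * T)

/-- Entries of `W_N`: row `i` is `(φ, ψ, λφ, λψ, …, λ^(N-1)φ, λ^(N-1)ψ)`. -/
def entryW (X T : ℂ) (i j : ℕ) (l : ℂ) : ℂ :=
  l ^ (j / 2) * (if Even j then phi X T l else psi i X T l)

/-- `W_N` with its last-but-one column replaced by `λ^N φ`. -/
def entry11 (N : ℕ) (X T : ℂ) (i j : ℕ) (l : ℂ) : ℂ :=
  if j + 2 = 2 * N then l ^ N * phi X T l else entryW X T i j l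

/-- `W_N` with its last column replaced by `λ^N φ`. -/
def entry12 (N : ℕ) (X T : ℂ) (i j : ℕ) (l : ℂ) : ℂ :=
  if j + 1 = 2 * N then l ^ N * phi X T l else entryW X T i j l

/-- `W_N` with its last-but-one column replaced by `λ^N ψ`. -/
def entry21 (N : ℕ) (X T : ℂ) (i j : ℕ) (l : ℂ) : ℂ :=
  if j + 2 = 2 * N then l ^ N * psi i X T l else entryW X T i j l

/-- The determinant with entries `e i j`, row `i` being taken at the eigenvalue `Λ i`. -/
def solitonDet (N : ℕ) (e : ℕ → ℕ → ℂ → ℂ) (Λ : Fin (2 * N) → ℂ) : ℂ :=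
  Matrix.det (Matrix.of fun i j : Fin (2 * N) => e i j (Λ i))

/-- `λ₁` for even, `λ₂` for odd rows. -/
def rowEigenvalue (l1 l2 : ℂ) (i : ℕ) : ℂ := if Even i then l1 else l2

/-- The degenerate determinant: the entries of row `i`, taken at `λ_k + ε`, are differentiated
`⌊i/2⌋` times in `ε` at `ε = 0`. -/
def positonDet (N : ℕ) (e : ℕ → ℕ → ℂ → ℂ) (l1 l2 : ℂ) : ℂ :=
  Matrix.det (Matrix.of fun i j : Fin (2 * N) =>
    iteratedDeriv ((i : ℕ) / 2) (fun ε : ℂ => e i j (rowEigenvalue l1 l2 i + ε)) 0)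

/-! ## `N`-soliton and `N`-positon formulas -/

/-- `|W_N|`. -/
def solitonW (N : ℕ) (Λ : Fin (2 * N) → ℂ) (X T : ℂ) : ℂ := solitonDet N (entryW X T) Λ

/-- `q^[N] = 2i Δ₁₂ / |W_N|` with `Δ₁₂ = -det(…)`. -/
def solitonQ (N : ℕ) (Λ : Fin (2 * N) → ℂ) (X T : ℂ) : ℂ :=
  2 * Complex.I * (-solitonDet N (entry12 N X T) Λ / solitonW N Λ X T)

/-- `r^[N] = -2i Δ₂₁ / |W_N|` with `Δ₂₁ = -det(…)`. -/
def solitonR (N : ℕ) (Λ : Fin (2 * N) → ℂ) (X T : ℂ) : ℂ :=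
  -(2 * Complex.I) * (-solitonDet N (entry21 N X T) Λ / solitonW N Λ X T)

/-- `x^[N] = X + 2i Δ₁₁ / |W_N|` with `Δ₁₁ = -det(…)`. -/
def solitonX (N : ℕ) (Λ : Fin (2 * N) → ℂ) (X T : ℂ) : ℂ :=
  X + 2 * Complex.I * (-solitonDet N (entry11 N X T) Λ / solitonW N Λ X T)

/-- `|W'_N|`. -/
def positonW (N : ℕ) (l1 l2 X T : ℂ) : ℂ := positonDet N (entryW X T) l1 l2

/-- `q_p^[N] = 2i Δ'₁₂ / |W'_N|`. -/
def positonQ (N : ℕ) (l1 l2 X T : ℂ) : ℂ :=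
  2 * Complex.I * (-positonDet N (entry12 N X T) l1 l2 / positonW N l1 l2 X T)

/-- `r_p^[N] = -2i Δ'₂₁ / |W'_N|`. -/
def positonR (N : ℕ) (l1 l2 X T : ℂ) : ℂ :=
  -(2 * Complex.I) * (-positonDet N (entry21 N X T) l1 l2 / positonW N l1 l2 X T)

/-- `x_p^[N] = X + 2i Δ'₁₁ / |W'_N|`. -/
def positonX (N : ℕ) (l1 l2 X T : ℂ) : ℂ :=
  X + 2 * Complex.I * (-positonDet N (entry11 N X T) l1 l2 / positonW N l1 l2 X T)

/-- `x_p^[N]` with the integration constant of the hodograph transformation fixed so that the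
reflection `(X,T) ↦ (-X,-T)` becomes `(x,t) ↦ (-x,-t)`. -/
def centredX (N : ℕ) (l1 l2 X T : ℂ) : ℂ :=
  positonX N l1 l2 X T + Complex.I * N * (l1 + l2)

/-- The points of the (complexified) `(X,T)`-plane where the positon formulas make sense. -/
def regularSet (N : ℕ) (l1 l2 : ℂ) : Set (ℂ × ℂ) := {p | positonW N l1 l2 p.1 p.2 ≠ 0}

/-! ## The equations -/

/-- `u`, `v` and `ρ = x_X` solve, on `D`, the reverse space-time nonlocal short pulse equation in
hodograph variables,
`u_XT = -2uρ`, `ρ_T = -(uv)_X`, `v(X,T) = -u(-X,-T)`, `ρ² - u_X v_X = 1`,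
and `x` is the hodograph coordinate: `dx = ρ dX - uv dT`. -/
structure SolvesHodographSystem (D : Set (ℂ × ℂ)) (u v x : ℂ → ℂ → ℂ) : Prop where
  isOpen : IsOpen D
  smooth_u : ContDiffOn ℂ ∞ (fun p : ℂ × ℂ => u p.1 p.2) D
  smooth_v : ContDiffOn ℂ ∞ (fun p : ℂ × ℂ => v p.1 p.2) D
  smooth_x : ContDiffOn ℂ ∞ (fun p : ℂ × ℂ => x p.1 p.2) D
  symm : ∀ X T, (X, T) ∈ D → (-X, -T) ∈ D
  reduction : ∀ X T, (X, T) ∈ D → v X T = -u (-X) (-T)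
  eqn_u : ∀ X T, (X, T) ∈ D →
    deriv (fun T' => deriv (fun X' => u X' T') X) T = -2 * u X T * deriv (fun X' => x X' T) X
  eqn_rho : ∀ X T, (X, T) ∈ D →
    deriv (fun T' => deriv (fun X' => x X' T') X) T = -deriv (fun X' => u X' T * v X' T) X
  constraint : ∀ X T, (X, T) ∈ D →
    deriv (fun X' => x X' T) X ^ 2
      - deriv (fun X' => u X' T) X * deriv (fun X' => v X' T) X = 1
  hodograph_T : ∀ X T, (X, T) ∈ D → deriv (fun T' => x X T') T = -(u X T * v X T)

/-- `q` is a smooth solution, on the open reflection-symmetric set `Ω` of the `(x,t)`-plane, of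
the focusing reverse space-time nonlocal short pulse equation
`q_xt(x,t) - 2 q(x,t) - (q(x,t) q(-x,-t) q_x(x,t))_x = 0`. Here `𝕜 = ℝ` or `𝕜 = ℂ`. -/
structure SolvesRST (𝕜 : Type) [NontriviallyNormedField 𝕜] [NormedSpace 𝕜 ℂ]
    (Ω : Set (𝕜 × 𝕜)) (q : 𝕜 → 𝕜 → ℂ) : Prop where
  isOpen : IsOpen Ω
  symm : ∀ x t, (x, t) ∈ Ω → (-x, -t) ∈ Ω
  smooth : ContDiffOn 𝕜 ∞ (fun p : 𝕜 × 𝕜 => q p.1 p.2) Ω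
  eqn : ∀ x t, (x, t) ∈ Ω →
    deriv (fun t' => deriv (fun x' => q x' t') x) t - 2 * q x t
      + deriv (fun x' => -(q x' t * q (-x') (-t) * deriv (fun y => q y t) x')) x = 0

/-- The change of variables `(X,T) ↦ (x(X,T), -T)` to the `(x,t)`-plane. -/
def hodographMap {𝕜 : Type} [Neg 𝕜] (x : 𝕜 → 𝕜 → 𝕜) (p : 𝕜 × 𝕜) : 𝕜 × 𝕜 := (x p.1 p.2, -p.2)

/-- `O` is a region of the `(X,T)`-plane on which `(X,T) ↦ (x(X,T), -T)` is a change of variables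
(one branch of the possibly multivalued, loop-like profile): open, reflection symmetric, contained
in `D`, with `x_X ≠ 0` and the map injective on it. -/
structure IsBranch {𝕜 : Type} [NontriviallyNormedField 𝕜]
    (D : Set (𝕜 × 𝕜)) (x : 𝕜 → 𝕜 → 𝕜) (O : Set (𝕜 × 𝕜)) : Prop where
  isOpen : IsOpen O
  subset : O ⊆ D
  symm : ∀ X T, (X, T) ∈ O → (-X, -T) ∈ O
  rho_ne_zero : ∀ X T, (X, T) ∈ O → deriv (fun X' => x X' T) X ≠ 0
  injOn : Set.InjOn (hodographMap x) O

/-- On every branch, the function `q` of `(x,t)` given parametrically by `q = u(X,T)`,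
`x = x(X,T)`, `t = -T` solves the reverse space-time nonlocal short pulse equation, and the
function `r(x,t) = -q(-x,-t)` is given by `v(X,T)`. -/
def SolvesRSTParametrically (𝕜 : Type) [NontriviallyNormedField 𝕜] [NormedSpace 𝕜 ℂ]
    (D : Set (𝕜 × 𝕜)) (u v : 𝕜 → 𝕜 → ℂ) (x : 𝕜 → 𝕜 → 𝕜) : Prop :=
  ∀ O : Set (𝕜 × 𝕜), IsBranch D x O → ∀ q : 𝕜 → 𝕜 → ℂ,
    (∀ X T, (X, T) ∈ O → q (x X T) (-T) = u X T) →
      SolvesRST 𝕜 (hodographMap x '' O) q ∧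
      ∀ X T, (X, T) ∈ O → v X T = -q (-x X T) T

/-! ## The explicit 2-positon (`λ₁ = iα₁`, `λ₂ = iα₂`; here `a = α₁`, `b = α₂`) -/

def H (a X T : ℂ) : ℂ := (2 * T * a ^ 2 - X) / a

def A1 (a b X T : ℂ) : ℂ :=
  2 * (a - b) * a ^ 2 * (2 * b ^ 2 - (a - b) * (2 * T * b ^ 2 + X)) * Complex.exp (H a X T)

def A2 (a b X T : ℂ) : ℂ :=
  2 * (a - b) * b ^ 2 * (2 * a ^ 2 + (a - b) * (2 * T * a ^ 2 + X)) * Complex.exp (H b X T)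

def A4 (a b X T : ℂ) : ℂ :=
  2 * a ^ 2 * b ^ 2 + (a - b) ^ 2 * (2 * T * a ^ 2 + X) * (2 * T * b ^ 2 + X)

def A3 (a b X T : ℂ) : ℂ :=
  X * A4 a b X T + 4 * (a + b) * a ^ 2 * b ^ 2
    + 2 * (a - b) ^ 2 * (b ^ 2 * (2 * T * a ^ 2 + X) + a ^ 2 * (2 * T * b ^ 2 + X))
    + 2 * (a - b) ^ 2 * (a + b) * (2 * T * a ^ 2 + X) * (2 * T * b ^ 2 + X)

def twoPositonDenom (a b X T : ℂ) : ℂ :=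
  2 * a ^ 2 * b ^ 2 * Complex.cosh (H a X T - H b X T) + A4 a b X T

def twoPositonQ (a b X T : ℂ) : ℂ := (A1 a b X T + A2 a b X T) / twoPositonDenom a b X T

def twoPositonX (a b X T : ℂ) : ℂ :=
  (2 * a ^ 2 * b ^ 2 * ((2 * a + 2 * b + X) * Complex.cosh (H a X T - H b X T)
      + (2 * a - 2 * b) * Complex.sinh (H a X T - H b X T)) + A3 a b X T)
    / twoPositonDenom a b X T

end RSTPositon

end

/-!
The degenerate matrix `W'_N` is the matrix of values of `2N` linear functionals, the derivatives of
order less than `N` at `λ₁` and at `λ₂`, on the functions `λ^k φ` and `λ^k ψ`. By the Leibniz rule,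
multiplication of functions by `λ` acts on the vectors of values through one constant Jordan matrix
(`shiftMatrix`). Hence the columns extend to a sequence `w_j` (`column`) with
`J w_j = w_(j+2)`, and the evolution of `φ` and `ψ` becomes `∂_T w_j = ∓i w_(j+2)` and
`∂_X w_(j+2) = ∓(i/2) w_j`, because differentiation in `X` or `T` commutes with the functionals.

Where `|W'_N| ≠ 0`, the columns `w_0, …, w_(2N-1)` are a basis, and Cramer's rule expresses the
expansions of `-w_(2N)` and `-w_(2N+1)` in it (`coeff`). These are the coefficients of the two rows
of the Darboux matrix, and `q`, `r`, `x` are read off from those of `λ^(N-1)`. Differentiating the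
two relations in `T` and in `X`, and comparing coefficients in the basis, gives the Lax pair in
coefficients (`deriv_T_coeff`, `deriv_X_coeff`). Its top coefficients are the evolution equations,
its constant terms give `ρ² - u_X v_X = 1` (`sq_deriv_X_a`), where the invertibility of `J` is
used. The reflection `(X, T) ↦ (-X, -T)` exchanges `φ` and `ψ` up to row signs, so it exchanges the
two rows of the Darboux matrix (`coeff_one_eq`), and comparing traces of `J` in the standard basis
and in the basis of columns (`coeff_add_coeff`) gives the constant which makes `x` odd. For
eigenvalues on the imaginary axis, complex conjugation multiplies the columns by signs, which makes
`x` real (`conj_coeff`).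

The passage to the `(x, t)`-plane is the inverse function theorem and the chain rule, for real and
complex variables at once (`solvesRSTParametrically_of_system`). For the degenerate limit, the rows
of the soliton matrices are replaced by divided differences, which changes all determinants by the
same non-zero factor; by Cauchy's integral formula divided differences tend to derivatives divided
by factorials when the nodes collapse (`tendsto_dividedDifference`). At the origin the matrix is
regular because a polynomial of degree less than `N` with a zero of order `N` vanishes.
-/

noncomputable section

namespace RSTPositon

/-! ### Partial derivatives of smooth functions -/

section Calculus

variable {𝕜 : Type*} [RCLike 𝕜] {E F : Type*} [NormedAddCommGroup E] [NormedSpace 𝕜 E]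
  [NormedAddCommGroup F] [NormedSpace 𝕜 F]

theorem hasDerivAt_fst_of_differentiableAt {f : 𝕜 × E → F} {t : 𝕜} {z : E}
    (hf : DifferentiableAt 𝕜 f (t, z)) :
    HasDerivAt (fun s => f (s, z)) (fderiv 𝕜 f (t, z) (1, 0)) t := by
  have h := hf.hasFDerivAt.comp_hasDerivAt t
    ((hasDerivAt_id t).prodMk (hasDerivAt_const t z))
  exact h

theorem hasDerivAt_snd_of_differentiableAt {f : E × 𝕜 → F} {t : E} {z : 𝕜}
    (hf : DifferentiableAt 𝕜 f (t, z)) :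
    HasDerivAt (fun s => f (t, s)) (fderiv 𝕜 f (t, z) (0, 1)) z := by
  have h := hf.hasFDerivAt.comp_hasDerivAt z
    ((hasDerivAt_const z t).prodMk (hasDerivAt_id z))
  exact h

theorem contDiffOn_deriv_snd {f : E × 𝕜 → F} {U : Set (E × 𝕜)} (hU : IsOpen U)
    (hf : ContDiffOn 𝕜 ∞ f U) :
    ContDiffOn 𝕜 ∞ (fun p : E × 𝕜 => deriv (fun s => f (p.1, s)) p.2) U := by
  have h := (hf.fderiv_of_isOpen hU (m := ∞) (by simp)).clm_apply
    (contDiffOn_const (c := ((0, 1) : E × 𝕜)))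
  refine h.congr fun p hp => ?_
  exact (hasDerivAt_snd_of_differentiableAt
    ((hf.contDiffAt (hU.mem_nhds hp)).differentiableAt (by simp))).deriv

theorem contDiffOn_deriv_fst {f : 𝕜 × E → F} {U : Set (𝕜 × E)} (hU : IsOpen U)
    (hf : ContDiffOn 𝕜 ∞ f U) :
    ContDiffOn 𝕜 ∞ (fun p : 𝕜 × E => deriv (fun s => f (s, p.2)) p.1) U := by
  have h := (hf.fderiv_of_isOpen hU (m := ∞) (by simp)).clm_apply
    (contDiffOn_const (c := ((1, 0) : 𝕜 × E)))
  refine h.congr fun p hp => ?_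
  exact (hasDerivAt_fst_of_differentiableAt
    ((hf.contDiffAt (hU.mem_nhds hp)).differentiableAt (by simp))).deriv

theorem ContDiffOn.differentiableAt_fst {f : 𝕜 × E → F} {U : Set (𝕜 × E)} (hU : IsOpen U)
    (hf : ContDiffOn 𝕜 ∞ f U) {t : 𝕜} {z : E} (h : (t, z) ∈ U) :
    DifferentiableAt 𝕜 (fun s => f (s, z)) t :=
  (hasDerivAt_fst_of_differentiableAt
    ((hf.contDiffAt (hU.mem_nhds h)).differentiableAt (by simp))).differentiableAt

theorem ContDiffOn.differentiableAt_snd {f : E × 𝕜 → F} {U : Set (E × 𝕜)} (hU : IsOpen U)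
    (hf : ContDiffOn 𝕜 ∞ f U) {t : E} {z : 𝕜} (h : (t, z) ∈ U) :
    DifferentiableAt 𝕜 (fun s => f (t, s)) z :=
  (hasDerivAt_snd_of_differentiableAt
    ((hf.contDiffAt (hU.mem_nhds h)).differentiableAt (by simp))).differentiableAt

theorem eventually_fst_mem {α β : Type*} [TopologicalSpace α] [TopologicalSpace β]
    {U : Set (α × β)} (hU : IsOpen U) {a : α} {b : β} (h : (a, b) ∈ U) :
    ∀ᶠ s in 𝓝 a, (s, b) ∈ U :=
  (Continuous.prodMk_left b).continuousAt.eventually_mem (hU.mem_nhds h)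

theorem eventually_snd_mem {α β : Type*} [TopologicalSpace α] [TopologicalSpace β]
    {U : Set (α × β)} (hU : IsOpen U) {a : α} {b : β} (h : (a, b) ∈ U) :
    ∀ᶠ s in 𝓝 b, (a, s) ∈ U :=
  (Continuous.prodMk_right a).continuousAt.eventually_mem (hU.mem_nhds h)

/-- Mixed partial derivatives of a smooth function commute. -/
theorem deriv_deriv_comm {f : 𝕜 × 𝕜 → F} {U : Set (𝕜 × 𝕜)} (hU : IsOpen U)
    (hf : ContDiffOn 𝕜 ∞ f U) {t z : 𝕜} (h : (t, z) ∈ U) :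
    deriv (fun t' => deriv (fun z' => f (t', z')) z) t
      = deriv (fun z' => deriv (fun t' => f (t', z')) t) z := by
  have hd : ∀ p ∈ U, DifferentiableAt 𝕜 f p := fun p hp =>
    (hf.contDiffAt (hU.mem_nhds hp)).differentiableAt (by simp)
  have hc := hf.contDiffAt (hU.mem_nhds h)
  have hsymm : IsSymmSndFDerivAt 𝕜 f (t, z) := hc.isSymmSndFDerivAt (by
    rw [minSmoothness_of_isRCLikeNormedField]; exact WithTop.coe_le_coe.2 (le_top (a := (2 : ℕ∞))))
  have hdd : DifferentiableAt 𝕜 (fderiv 𝕜 f) (t, z) :=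
    ((hf.fderiv_of_isOpen hU (m := ∞) (by simp)).contDiffAt
      (hU.mem_nhds h)).differentiableAt (by simp)
  have e1 : (fun t' => deriv (fun z' => f (t', z')) z) =ᶠ[𝓝 t]
      fun t' => fderiv 𝕜 f (t', z) (0, 1) := by
    filter_upwards [eventually_fst_mem hU h] with s hs
    exact (hasDerivAt_snd_of_differentiableAt (hd _ hs)).deriv
  have e2 : (fun z' => deriv (fun t' => f (t', z')) t) =ᶠ[𝓝 z]
      fun z' => fderiv 𝕜 f (t, z') (1, 0) := by
    filter_upwards [eventually_snd_mem hU h] with s hs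
    exact (hasDerivAt_fst_of_differentiableAt (hd _ hs)).deriv
  rw [e1.deriv_eq, e2.deriv_eq,
    ((hasDerivAt_fst_of_differentiableAt hdd).clm_apply (hasDerivAt_const t _)).deriv,
    ((hasDerivAt_snd_of_differentiableAt hdd).clm_apply (hasDerivAt_const z _)).deriv]
  simpa using hsymm (1, 0) (0, 1)

/-- Iterated derivatives in the last variable stay smooth in all variables. -/
theorem contDiffOn_iteratedDeriv_snd {f : E × 𝕜 → F} {U : Set (E × 𝕜)} (hU : IsOpen U)
    (hf : ContDiffOn 𝕜 ∞ f U) (m : ℕ) :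
    ContDiffOn 𝕜 ∞ (fun p : E × 𝕜 => iteratedDeriv m (fun s => f (p.1, s)) p.2) U := by
  induction m generalizing f with
  | zero => simpa using hf
  | succ m ih =>
    have := ih (contDiffOn_deriv_snd hU hf)
    simp only [iteratedDeriv_succ']
    exact this

/-- Differentiation in a parameter commutes with iterated differentiation in the variable. -/
theorem hasDerivAt_iteratedDeriv {f : 𝕜 × 𝕜 → F} {U : Set (𝕜 × 𝕜)} (hU : IsOpen U)
    (hf : ContDiffOn 𝕜 ∞ f U) (m : ℕ) {t z : 𝕜} (h : (t, z) ∈ U) :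
    HasDerivAt (fun t' => iteratedDeriv m (fun z' => f (t', z')) z)
      (iteratedDeriv m (fun z' => deriv (fun t' => f (t', z')) t) z) t := by
  induction m generalizing f with
  | zero =>
    simpa using (ContDiffOn.differentiableAt_fst hU hf h).hasDerivAt
  | succ m ih =>
    have := ih (contDiffOn_deriv_snd hU hf)
    simp only [iteratedDeriv_succ']
    convert this using 1
    refine Filter.EventuallyEq.iteratedDeriv_eq _ ?_
    filter_upwards [eventually_snd_mem hU h] with s hs
    exact (deriv_deriv_comm hU hf hs).symm

/-- The Leibniz rule for multiplication by the variable. -/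
theorem iteratedDeriv_id_mul {f : ℂ → ℂ} {z : ℂ} (hf : ContDiffAt ℂ ∞ f z) (m : ℕ) :
    iteratedDeriv m (fun s => s * f s) z
      = z * iteratedDeriv m f z + m * iteratedDeriv (m - 1) f z := by
  change iteratedDeriv m (fun s => id s * f s) z = _
  rw [iteratedDeriv_fun_mul contDiffAt_id (hf.of_le (by exact_mod_cast le_top))]
  rcases m with _ | m
  · simp
  · rw [Finset.sum_range_succ', Finset.sum_range_succ']
    have h0 : ∀ i ∈ Finset.range m, (((m + 1).choose (i + 1 + 1) : ℕ) : ℂ)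
        * iteratedDeriv (i + 1 + 1) id z * iteratedDeriv (m + 1 - (i + 1 + 1)) f z = 0 := by
      intro i _
      have : iteratedDeriv (i + 1 + 1) (id : ℂ → ℂ) z = 0 := by
        simp [iteratedDeriv_succ', iteratedDeriv_const]
      rw [this]; ring
    rw [Finset.sum_eq_zero h0]
    simp [iteratedDeriv_one]
    ring

end Calculus

/-! ### The hodograph transformation -/

section Hodograph

variable {𝕜 : Type} [RCLike 𝕜]

/-- The differential of `(X, T) ↦ (x(X, T), -T)` in terms of `ρ = x_X ≠ 0` and `τ = x_T`. -/
def hodographEquiv (ρ τ : 𝕜) (hρ : ρ ≠ 0) : (𝕜 × 𝕜) ≃L[𝕜] (𝕜 × 𝕜) :=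
  ContinuousLinearEquiv.equivOfInverse
    ((ρ • ContinuousLinearMap.fst 𝕜 𝕜 𝕜 + τ • ContinuousLinearMap.snd 𝕜 𝕜 𝕜).prod
      (-ContinuousLinearMap.snd 𝕜 𝕜 𝕜))
    ((ρ⁻¹ • (ContinuousLinearMap.fst 𝕜 𝕜 𝕜 + τ • ContinuousLinearMap.snd 𝕜 𝕜 𝕜)).prod
      (-ContinuousLinearMap.snd 𝕜 𝕜 𝕜))
    (fun p => by
      ext
      · simp
        field_simp
        ring
      · simp)
    (fun p => by
      ext
      · simp
        field_simp
        ring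
      · simp)

variable {x : 𝕜 → 𝕜 → 𝕜} {O : Set (𝕜 × 𝕜)}

theorem fderiv_eq_of_partials {F : Type*} [NormedAddCommGroup F] [NormedSpace 𝕜 F]
    {f : 𝕜 × 𝕜 → F} {X T : 𝕜} (hf : DifferentiableAt 𝕜 f (X, T)) (a b : 𝕜) :
    fderiv 𝕜 f (X, T) (a, b)
      = a • deriv (fun s => f (s, T)) X + b • deriv (fun s => f (X, s)) T := by
  rw [(hasDerivAt_fst_of_differentiableAt hf).deriv, (hasDerivAt_snd_of_differentiableAt hf).deriv,
    ← map_smul, ← map_smul, ← map_add]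
  simp

theorem contDiffOn_hodographMap (hx : ContDiffOn 𝕜 ∞ (fun p : 𝕜 × 𝕜 => x p.1 p.2) O) :
    ContDiffOn 𝕜 ∞ (hodographMap x) O :=
  hx.prodMk contDiffOn_snd.neg

theorem hasFDerivAt_hodographMap (hO : IsOpen O)
    (hx : ContDiffOn 𝕜 ∞ (fun p : 𝕜 × 𝕜 => x p.1 p.2) O) {X T : 𝕜} (h : (X, T) ∈ O)
    (hρ : deriv (fun X' => x X' T) X ≠ 0) :
    HasFDerivAt (hodographMap x)
      (hodographEquiv (deriv (fun X' => x X' T) X) (deriv (fun T' => x X T') T) hρ :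
        (𝕜 × 𝕜) →L[𝕜] (𝕜 × 𝕜)) (X, T) := by
  have hd : DifferentiableAt 𝕜 (fun p : 𝕜 × 𝕜 => x p.1 p.2) (X, T) :=
    (hx.contDiffAt (hO.mem_nhds h)).differentiableAt (by simp)
  have h1 := hd.hasFDerivAt.prodMk (hasFDerivAt_snd (𝕜 := 𝕜) (p := (X, T))).neg
  refine h1.congr_fderiv ?_
  refine ContinuousLinearMap.ext fun p => Prod.ext ?_ ?_
  · rw [ContinuousLinearMap.prod_apply, fderiv_eq_of_partials hd]
    simp [hodographEquiv, mul_comm]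
  · simp [hodographEquiv]

theorem exists_localInverse_hodographMap (hO : IsOpen O)
    (hx : ContDiffOn 𝕜 ∞ (fun p : 𝕜 × 𝕜 => x p.1 p.2) O) {X T : 𝕜} (h : (X, T) ∈ O)
    (hρ : deriv (fun X' => x X' T) X ≠ 0) :
    ∃ g : 𝕜 × 𝕜 → 𝕜 × 𝕜, ContDiffAt 𝕜 ∞ g (hodographMap x (X, T)) ∧
      g (hodographMap x (X, T)) = (X, T) ∧
      ∀ᶠ y in 𝓝 (hodographMap x (X, T)), g y ∈ O ∧ hodographMap x (g y) = y := by
  have hc := (contDiffOn_hodographMap hx).contDiffAt (hO.mem_nhds h)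
  have hf := hasFDerivAt_hodographMap hO hx h hρ
  have hn : (∞ : WithTop ℕ∞) ≠ 0 := by simp
  have hg := hc.to_localInverse hf hn
  have hpt := hc.localInverse_apply_image hf hn
  refine ⟨hc.localInverse hf hn, hg, hpt, ?_⟩
  have h1 : ∀ᶠ y in 𝓝 (hodographMap x (X, T)), hc.localInverse hf hn y ∈ O :=
    hg.continuousAt.eventually_mem (by rw [hpt]; exact hO.mem_nhds h)
  have h2 := (hc.hasStrictFDerivAt' hf hn).eventually_right_inverse
  filter_upwards [h1, h2] with y hy1 hy2
  exact ⟨hy1, hy2⟩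

theorem isOpen_image_hodographMap (hO : IsOpen O)
    (hx : ContDiffOn 𝕜 ∞ (fun p : 𝕜 × 𝕜 => x p.1 p.2) O)
    (hρ : ∀ X T, (X, T) ∈ O → deriv (fun X' => x X' T) X ≠ 0) :
    IsOpen (hodographMap x '' O) := by
  rw [isOpen_iff_mem_nhds]
  rintro _ ⟨⟨X, T⟩, h, rfl⟩
  obtain ⟨g, -, -, hg⟩ := exists_localInverse_hodographMap hO hx h (hρ X T h)
  filter_upwards [hg] with y hy
  exact ⟨g y, hy.1, hy.2⟩

theorem contDiffOn_of_comp_hodographMap {F : Type*} [NormedAddCommGroup F] [NormedSpace 𝕜 F]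
    (hO : IsOpen O) (hx : ContDiffOn 𝕜 ∞ (fun p : 𝕜 × 𝕜 => x p.1 p.2) O)
    (hρ : ∀ X T, (X, T) ∈ O → deriv (fun X' => x X' T) X ≠ 0) {u q : 𝕜 × 𝕜 → F}
    (hu : ContDiffOn 𝕜 ∞ u O) (hq : ∀ p ∈ O, q (hodographMap x p) = u p) :
    ContDiffOn 𝕜 ∞ q (hodographMap x '' O) := by
  rintro _ ⟨⟨X, T⟩, h, rfl⟩
  obtain ⟨g, hgc, hgp, hg⟩ := exists_localInverse_hodographMap hO hx h (hρ X T h)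
  have huc : ContDiffAt 𝕜 ∞ u (g (hodographMap x (X, T))) := by
    rw [hgp]; exact hu.contDiffAt (hO.mem_nhds h)
  refine ((huc.comp _ hgc).congr_of_eventuallyEq ?_).contDiffWithinAt
  filter_upwards [hg] with y hy
  rw [Function.comp_apply, ← hq _ hy.1, hy.2]

section Chain

variable {F : Type*} [NormedAddCommGroup F] [NormedSpace 𝕜 F] {f F' : 𝕜 × 𝕜 → F}

/-- `(f ∘ h)_X = x_X f_x` for the change of variables `h`. -/
theorem deriv_X_comp_hodographMap (hO : IsOpen O)
    (hx : ContDiffOn 𝕜 ∞ (fun p : 𝕜 × 𝕜 => x p.1 p.2) O) {X T : 𝕜} (h : (X, T) ∈ O)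
    (hf : DifferentiableAt 𝕜 f (hodographMap x (X, T)))
    (hF : ∀ p ∈ O, f (hodographMap x p) = F' p) :
    deriv (fun X' => F' (X', T)) X
      = deriv (fun X' => x X' T) X • deriv (fun s => f (s, -T)) (x X T) := by
  have h1 : HasDerivAt (fun X' => (x X' T, -T)) (deriv (fun X' => x X' T) X, (0 : 𝕜)) X :=
    (ContDiffOn.differentiableAt_fst hO hx h).hasDerivAt.prodMk (hasDerivAt_const X (-T))
  have h2 : HasDerivAt (fun X' => f (x X' T, -T)) _ X := hf.hasFDerivAt.comp_hasDerivAt X h1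
  have e : (fun X' => F' (X', T)) =ᶠ[𝓝 X] fun X' => f (x X' T, -T) := by
    filter_upwards [eventually_fst_mem hO h] with s hs
    exact (hF _ hs).symm
  rw [e.deriv_eq, h2.deriv, hodographMap, fderiv_eq_of_partials hf]
  simp

/-- `(f ∘ h)_T = x_T f_x - f_t` for the change of variables `h`. -/
theorem deriv_T_comp_hodographMap (hO : IsOpen O)
    (hx : ContDiffOn 𝕜 ∞ (fun p : 𝕜 × 𝕜 => x p.1 p.2) O) {X T : 𝕜} (h : (X, T) ∈ O)
    (hf : DifferentiableAt 𝕜 f (hodographMap x (X, T)))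
    (hF : ∀ p ∈ O, f (hodographMap x p) = F' p) :
    deriv (fun T' => F' (X, T')) T
      = deriv (fun T' => x X T') T • deriv (fun s => f (s, -T)) (x X T)
        - deriv (fun s => f (x X T, s)) (-T) := by
  have h1 : HasDerivAt (fun T' => (x X T', -T')) (deriv (fun T' => x X T') T, (-1 : 𝕜)) T :=
    (ContDiffOn.differentiableAt_snd hO hx h).hasDerivAt.prodMk (hasDerivAt_neg T)
  have h2 : HasDerivAt (fun T' => f (x X T', -T')) _ T := hf.hasFDerivAt.comp_hasDerivAt T h1
  have e : (fun T' => F' (X, T')) =ᶠ[𝓝 T] fun T' => f (x X T', -T') := by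
    filter_upwards [eventually_snd_mem hO h] with s hs
    exact (hF _ hs).symm
  rw [e.deriv_eq, h2.deriv, hodographMap, fderiv_eq_of_partials hf]
  simp [sub_eq_add_neg]

end Chain

/-- A solution of the hodograph system with odd `x` gives, on every branch, a solution of the
reverse space-time nonlocal short pulse equation. -/
theorem solvesRSTParametrically_of_system [NormedAlgebra 𝕜 ℂ] {D : Set (𝕜 × 𝕜)}
    {u v : 𝕜 → 𝕜 → ℂ} {x : 𝕜 → 𝕜 → 𝕜}
    (hu : ContDiffOn 𝕜 ∞ (fun p : 𝕜 × 𝕜 => u p.1 p.2) D)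
    (hx : ContDiffOn 𝕜 ∞ (fun p : 𝕜 × 𝕜 => x p.1 p.2) D)
    (eqn_u : ∀ X T, (X, T) ∈ D → deriv (fun T' => deriv (fun X' => u X' T') X) T
      = -2 * u X T * algebraMap 𝕜 ℂ (deriv (fun X' => x X' T) X))
    (hodograph_T : ∀ X T, (X, T) ∈ D →
      algebraMap 𝕜 ℂ (deriv (fun T' => x X T') T) = -(u X T * v X T))
    (reduction : ∀ X T, (X, T) ∈ D → v X T = -u (-X) (-T))
    (odd_x : ∀ X T, (X, T) ∈ D → x (-X) (-T) = -x X T) :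
    SolvesRSTParametrically 𝕜 D u v x := by
  intro O hO q hq
  have hOo := hO.isOpen
  replace hu := hu.mono hO.subset
  replace hx := hx.mono hO.subset
  have hneg : ∀ X T, (X, T) ∈ O → q (-x X T) T = u (-X) (-T) := by
    intro X T h
    have := hq _ _ (hO.symm X T h)
    rwa [odd_x X T (hO.subset h), neg_neg] at this
  have hΩ := isOpen_image_hodographMap hOo hx hO.rho_ne_zero
  have hqs : ContDiffOn 𝕜 ∞ (fun p : 𝕜 × 𝕜 => q p.1 p.2) (hodographMap x '' O) :=
    contDiffOn_of_comp_hodographMap hOo hx hO.rho_ne_zero hu fun p hp => hq p.1 p.2 hp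
  have hsymm : ∀ y t, (y, t) ∈ hodographMap x '' O → (-y, -t) ∈ hodographMap x '' O := by
    rintro y t ⟨⟨X, T⟩, h, hyt⟩
    obtain ⟨rfl, rfl⟩ := Prod.mk.inj hyt
    refine ⟨(-X, -T), hO.symm X T h, ?_⟩
    simp [hodographMap, odd_x X T (hO.subset h)]
  refine ⟨⟨hΩ, hsymm, hqs, ?_⟩, fun X T h => ?_⟩
  swap
  · rw [hneg X T h, reduction X T (hO.subset h)]
  rintro y t ⟨⟨X, T⟩, h, hyt⟩
  obtain ⟨rfl, rfl⟩ := Prod.mk.inj hyt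
  dsimp only
  have hmem : ∀ {p}, p ∈ O → hodographMap x p ∈ hodographMap x '' O :=
    fun hp => Set.mem_image_of_mem _ hp
  have hdiff : ∀ {f : 𝕜 × 𝕜 → ℂ}, ContDiffOn 𝕜 ∞ f (hodographMap x '' O) → ∀ {p}, p ∈ O →
      DifferentiableAt 𝕜 f (hodographMap x p) := fun hf p hp =>
    (hf.contDiffAt (hΩ.mem_nhds (hmem hp))).differentiableAt (by simp)
  -- `q_x` as a function of `(X, T)` and of `(x, t)`
  set P : 𝕜 × 𝕜 → ℂ := fun p => deriv (fun s => q s (-p.2)) (x p.1 p.2) with hP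
  have hqxs := contDiffOn_deriv_fst hΩ hqs
  have hqx : ∀ p ∈ O, (fun y : 𝕜 × 𝕜 => deriv (fun s => q s y.2) y.1) (hodographMap x p) = P p :=
    fun p _ => rfl
  have huX : ∀ p ∈ O, deriv (fun X' => u X' p.2) p.1
      = deriv (fun X' => x X' p.2) p.1 • P p := by
    rintro ⟨X, T⟩ hp
    exact deriv_X_comp_hodographMap hOo hx hp (hdiff hqs hp)
      (F' := fun p => u p.1 p.2) fun p hp => hq p.1 p.2 hp
  have hPX := deriv_X_comp_hodographMap hOo hx h (hdiff hqxs h) hqx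
  have hPT := deriv_T_comp_hodographMap hOo hx h (hdiff hqxs h) hqx
  have hPs : ContDiffOn 𝕜 ∞ P O := by
    have := hqxs.comp (contDiffOn_hodographMap hx) fun p hp => hmem hp
    exact this
  -- the flux `-q(x,t) q(-x,-t) q_x(x,t)`, which equals `-x_T q_x` in the variables `(X, T)`
  have hGs : ContDiffOn 𝕜 ∞ (fun p : 𝕜 × 𝕜 =>
      -(q p.1 p.2 * q (-p.1) (-p.2) * deriv (fun s => q s p.2) p.1)) (hodographMap x '' O) := by
    have hneg' : ContDiffOn 𝕜 ∞ (fun p : 𝕜 × 𝕜 => q (-p.1) (-p.2)) (hodographMap x '' O) :=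
      hqs.comp (contDiff_neg (𝕜 := 𝕜) (F := 𝕜 × 𝕜)).contDiffOn fun p hp => hsymm p.1 p.2 hp
    exact ((hqs.mul hneg').mul hqxs).neg
  have hG : ∀ p ∈ O, (fun p : 𝕜 × 𝕜 =>
      -(q p.1 p.2 * q (-p.1) (-p.2) * deriv (fun s => q s p.2) p.1)) (hodographMap x p)
        = -(deriv (fun T' => x p.1 T') p.2 • P p) := by
    rintro ⟨X, T⟩ hp
    rw [Algebra.smul_def, hodograph_T X T (hO.subset hp)]
    simp only [hodographMap, neg_neg, hq X T hp, hneg X T hp]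
    rw [reduction X T (hO.subset hp)]
    simp only [hP]
    ring
  have hGX := deriv_X_comp_hodographMap hOo hx h (hdiff hGs h) hG
  have hxX := contDiffOn_deriv_fst hOo hx
  have hxT := contDiffOn_deriv_snd hOo hx
  have hmix := deriv_deriv_comm hOo hx h
  -- differentiate `u_X = x_X q_x` in `T` and `x_T q_x` in `X`
  have h1 : deriv (fun T' => deriv (fun X' => u X' T') X) T
      = deriv (fun X' => x X' T) X • deriv (fun T' => P (X, T')) T
        + deriv (fun T' => deriv (fun X' => x X' T') X) T • P (X, T) := by
    have e : (fun T' => deriv (fun X' => u X' T') X) =ᶠ[𝓝 T]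
        fun T' => deriv (fun X' => x X' T') X • P (X, T') := by
      filter_upwards [eventually_snd_mem hOo h] with s hs
      exact huX _ hs
    rw [e.deriv_eq]
    exact ((ContDiffOn.differentiableAt_snd hOo hxX h).hasDerivAt.fun_smul
      (ContDiffOn.differentiableAt_snd hOo hPs h).hasDerivAt).deriv
  have h2 : deriv (fun X' => -(deriv (fun T' => x X' T') T • P (X', T))) X
      = -(deriv (fun T' => x X T') T • deriv (fun X' => P (X', T)) X
        + deriv (fun X' => deriv (fun T' => x X' T') T) X • P (X, T)) :=
    ((ContDiffOn.differentiableAt_fst hOo hxT h).hasDerivAt.fun_smul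
      (ContDiffOn.differentiableAt_fst hOo hPs h).hasDerivAt).fun_neg.deriv
  have h3 := eqn_u X T (hO.subset h)
  have hρ : algebraMap 𝕜 ℂ (deriv (fun X' => x X' T) X) ≠ 0 := by
    simpa using hO.rho_ne_zero X T h
  simp only [Algebra.smul_def] at hPX hPT hGX h1 h2
  rw [h2, hPX, hmix] at hGX
  rw [h3, hPT] at h1
  rw [hq X T h]
  refine mul_left_cancel₀ hρ ?_
  linear_combination h1 - hGX

end Hodograph

/-! ### The columns of the degenerate matrix -/

section Columns

/-- The factor in `∂_T (λ^k φ) = -i λ^(k+1) φ` (even columns) and `∂_T (λ^k ψ) = i λ^(k+1) ψ` (odd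
columns); half of it is the factor in `λ ∂_X`. -/
def dispersion (j : ℕ) : ℂ := if Even j then -Complex.I else Complex.I

/-- The sign `s_i` in `ψ_i(X, T) = s_i φ(-X, -T)`. -/
def rowSign (i : ℕ) : ℂ := if Even i then 1 else -1

theorem rowSign_mul_self (i : ℕ) : rowSign i * rowSign i = 1 := by
  unfold rowSign; split_ifs <;> simp

theorem rowEigenvalue_ne_zero {l1 l2 : ℂ} (h1 : l1 ≠ 0) (h2 : l2 ≠ 0) (i : ℕ) :
    rowEigenvalue l1 l2 i ≠ 0 := by
  unfold rowEigenvalue; split_ifs <;> assumption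

theorem entryW_congr {i k : ℕ} (h : Even i ↔ Even k) (X T : ℂ) (j : ℕ) :
    entryW X T i j = entryW X T k j := by
  funext l; simp only [entryW, psi, h]

theorem entryW_add_two (X T : ℂ) (i j : ℕ) (l : ℂ) :
    entryW X T i (j + 2) l = l * entryW X T i j l := by
  have : (j + 2) / 2 = j / 2 + 1 := by omega
  simp only [entryW, this, Nat.even_add, even_two, iff_true]
  ring

theorem entryW_eq (X T : ℂ) (i j : ℕ) (l : ℂ) :
    entryW X T i j l = (if Even j then 1 else rowSign i) * l ^ (j / 2)
      * Complex.exp (dispersion j * (X / (2 * l) + l * T)) := by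
  unfold entryW phi psi dispersion rowSign
  split_ifs <;> ring_nf

theorem hasDerivAt_entryW_T (X T : ℂ) (i j : ℕ) (l : ℂ) :
    HasDerivAt (fun t => entryW X t i j l) (dispersion j * entryW X T i (j + 2) l) T := by
  simp only [entryW_add_two, entryW_eq]
  refine (((((hasDerivAt_id T).const_mul l).const_add (X / (2 * l))).const_mul
    (dispersion j)).cexp.const_mul _).congr_deriv ?_
  simp only [id]
  ring

theorem hasDerivAt_entryW_X (X T : ℂ) (i j : ℕ) {l : ℂ} (hl : l ≠ 0) :
    HasDerivAt (fun x => entryW x T i (j + 2) l) (dispersion j / 2 * entryW X T i j l) X := by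
  simp only [entryW_add_two, entryW_eq]
  refine ((((((hasDerivAt_id X).div_const (2 * l)).add_const (l * T)).const_mul
    (dispersion j)).cexp.const_mul _).const_mul l).congr_deriv ?_
  simp only [id]
  field_simp

theorem entryW_neg_even (X T : ℂ) (i k : ℕ) (l : ℂ) :
    entryW (-X) (-T) i (2 * k) l = rowSign i * entryW X T i (2 * k + 1) l := by
  have h1 : (2 * k + 1) / 2 = k := by omega
  have h2 : ¬ Even (2 * k + 1) := by simp
  have h3 : psi i X T l = rowSign i * phi (-X) (-T) l := by
    unfold psi rowSign phi
    congr 2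
    ring
  simp only [entryW, h1, h2, h3, if_false, even_two_mul, if_true]
  rw [mul_left_comm, ← mul_assoc (rowSign i), rowSign_mul_self]
  simp

theorem entryW_neg_odd (X T : ℂ) (i k : ℕ) (l : ℂ) :
    entryW (-X) (-T) i (2 * k + 1) l = rowSign i * entryW X T i (2 * k) l := by
  have := entryW_neg_even (-X) (-T) i k l
  rw [neg_neg, neg_neg] at this
  rw [this, ← mul_assoc, rowSign_mul_self, one_mul]

theorem isOpen_snd_ne_zero (E : Type*) [TopologicalSpace E] :
    IsOpen {p : E × ℂ | p.2 ≠ 0} :=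
  isOpen_ne.preimage continuous_snd

/-- The entries are holomorphic in `X`, `T` and `λ ≠ 0` jointly. -/
theorem contDiffOn_entryW (i j : ℕ) :
    ContDiffOn ℂ ∞ (fun p : (ℂ × ℂ) × ℂ => entryW p.1.1 p.1.2 i j p.2) {p | p.2 ≠ 0} := by
  have hq : ContDiffOn ℂ ∞ (fun p : (ℂ × ℂ) × ℂ => Complex.I * p.1.1 / (2 * p.2))
      {p | p.2 ≠ 0} :=
    ContDiffOn.div (by fun_prop) (by fun_prop) fun p hp => mul_ne_zero two_ne_zero hp
  have hp : ContDiffOn ℂ ∞ (fun p : (ℂ × ℂ) × ℂ => phi p.1.1 p.1.2 p.2) {p | p.2 ≠ 0} := by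
    unfold phi
    exact (hq.neg.sub (by fun_prop)).cexp
  have hs : ContDiffOn ℂ ∞ (fun p : (ℂ × ℂ) × ℂ => psi i p.1.1 p.1.2 p.2) {p | p.2 ≠ 0} := by
    unfold psi
    exact contDiffOn_const.mul (hq.add (by fun_prop)).cexp
  unfold entryW
  split_ifs
  · exact ContDiffOn.mul (by fun_prop) hp
  · exact ContDiffOn.mul (by fun_prop) hs

theorem contDiffAt_entryW (X T : ℂ) (i j : ℕ) {l : ℂ} (hl : l ≠ 0) :
    ContDiffAt ℂ ∞ (entryW X T i j) l :=
  ((contDiffOn_entryW i j).contDiffAt ((isOpen_snd_ne_zero _).mem_nhds (x := ((X, T), l)) hl)).comp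
    l (contDiffAt_const.prodMk contDiffAt_id)

variable (N : ℕ) (l1 l2 : ℂ)

/-- Column `j` of the degenerate matrix, for all `j`: even and odd `j` are the vectors of
derivatives of `λ^(j/2) φ` and `λ^(j/2) ψ`. -/
def column (j : ℕ) (X T : ℂ) : Fin (2 * N) → ℂ := fun i =>
  iteratedDeriv ((i : ℕ) / 2) (entryW X T i j) (rowEigenvalue l1 l2 i)

/-- The matrix by which multiplication of functions by `λ` acts on the vectors of derivatives at
`λ₁` and `λ₂`: by the Leibniz rule it has the Jordan form of two blocks of size `N`. -/
def shiftMatrix : Matrix (Fin (2 * N)) (Fin (2 * N)) ℂ := Matrix.of fun i k =>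
  (if k = i then rowEigenvalue l1 l2 i else 0) + (if (k : ℕ) + 2 = i then ((i / 2 : ℕ) : ℂ) else 0)

theorem positonDet_eq (e : ℕ → ℕ → ℂ → ℂ) :
    positonDet N e l1 l2 = Matrix.det (Matrix.of fun i j : Fin (2 * N) =>
      iteratedDeriv ((i : ℕ) / 2) (e i j) (rowEigenvalue l1 l2 i)) := by
  simp [positonDet, iteratedDeriv_comp_const_add]

variable {l1 l2}

theorem contDiff_column (h1 : l1 ≠ 0) (h2 : l2 ≠ 0) (j : ℕ) :
    ContDiff ℂ ∞ (fun p : ℂ × ℂ => column N l1 l2 j p.1 p.2) := by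
  refine contDiff_pi.2 fun i => ?_
  have h := contDiffOn_iteratedDeriv_snd (isOpen_snd_ne_zero _)
    (contDiffOn_entryW i j) ((i : ℕ) / 2)
  have hf : ContDiff ℂ ∞ (fun p : ℂ × ℂ => (p, rowEigenvalue l1 l2 i)) :=
    contDiff_id.prodMk contDiff_const
  exact contDiffOn_univ.1 (h.comp (f := fun p : ℂ × ℂ => (p, rowEigenvalue l1 l2 i))
    hf.contDiffOn fun p _ => rowEigenvalue_ne_zero h1 h2 i)

theorem shiftMatrix_mulVec_apply (v : Fin (2 * N) → ℂ) (i : Fin (2 * N)) :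
    (shiftMatrix N l1 l2).mulVec v i = rowEigenvalue l1 l2 i * v i
      + ((i / 2 : ℕ) : ℂ) * v ⟨i - 2, by omega⟩ := by
  simp only [Matrix.mulVec, dotProduct, shiftMatrix, Matrix.of_apply, add_mul,
    Finset.sum_add_distrib, ite_mul, zero_mul, Finset.sum_ite_eq', Finset.mem_univ, if_true]
  congr 1
  by_cases h : 2 ≤ (i : ℕ)
  · rw [Finset.sum_eq_single (⟨i - 2, by omega⟩ : Fin (2 * N))]
    · rw [if_pos (by simp; omega)]
    · intro k _ hk
      rw [if_neg]
      intro h'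
      exact hk (Fin.ext (by simp; omega))
    · simp
  · have : (i : ℕ) / 2 = 0 := by omega
    simp [this]

/-- The vectors of derivatives of `λ f` are obtained from those of `f` by `shiftMatrix`. -/
theorem shiftMatrix_mulVec_column (h1 : l1 ≠ 0) (h2 : l2 ≠ 0) (j : ℕ) (X T : ℂ) :
    (shiftMatrix N l1 l2).mulVec (column N l1 l2 j X T) = column N l1 l2 (j + 2) X T := by
  funext i
  rw [shiftMatrix_mulVec_apply]
  have hl := rowEigenvalue_ne_zero h1 h2 i
  have e : entryW X T i (j + 2) = fun l => l * entryW X T i j l :=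
    funext (entryW_add_two X T i j)
  simp only [column]
  rw [e, iteratedDeriv_id_mul (contDiffAt_entryW X T i j hl)]
  congr 1
  by_cases h : 2 ≤ (i : ℕ)
  · have hi : Even ((i : ℕ) - 2) ↔ Even (i : ℕ) := by
      rw [Nat.even_sub h]; simp
    have h3 : ((i : ℕ) - 2) / 2 = (i : ℕ) / 2 - 1 := by omega
    rw [entryW_congr hi, h3]
    simp only [rowEigenvalue, hi]
  · have : (i : ℕ) / 2 = 0 := by omega
    simp [this]

/-- `shiftMatrix` is lower triangular with non-zero diagonal, so it is injective. -/
theorem shiftMatrix_mulVec_eq_zero (h1 : l1 ≠ 0) (h2 : l2 ≠ 0) {v : Fin (2 * N) → ℂ}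
    (h : (shiftMatrix N l1 l2).mulVec v = 0) : v = 0 := by
  have key : ∀ n : ℕ, ∀ hn : n < 2 * N, v ⟨n, hn⟩ = 0 := by
    intro n
    induction n using Nat.strong_induction_on with
    | _ n ih =>
      intro hn
      have h' := congrFun h ⟨n, hn⟩
      rw [shiftMatrix_mulVec_apply] at h'
      have h0 : (((n / 2 : ℕ) : ℂ)) * v ⟨n - 2, by omega⟩ = 0 := by
        by_cases h2 : 2 ≤ n
        · rw [ih (n - 2) (by omega), mul_zero]
        · have : n / 2 = 0 := by omega
          simp [this]
      simp only [h0, add_zero, Pi.zero_apply] at h'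
      exact (mul_eq_zero.1 h').resolve_left (rowEigenvalue_ne_zero h1 h2 n)
  funext i
  exact key i i.2

theorem sum_range_two_mul {M : Type*} [AddCommMonoid M] (f : ℕ → M) (n : ℕ) :
    ∑ j ∈ Finset.range (2 * n), f j = ∑ k ∈ Finset.range n, (f (2 * k) + f (2 * k + 1)) := by
  induction n with
  | zero => simp
  | succ n ih =>
    rw [Nat.mul_succ, Finset.sum_range_succ, Finset.sum_range_succ, Finset.sum_range_succ, ih,
      add_assoc]

theorem trace_shiftMatrix : (shiftMatrix N l1 l2).trace = N * (l1 + l2) := by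
  have : ∀ i : Fin (2 * N), (shiftMatrix N l1 l2).diag i = rowEigenvalue l1 l2 i := by
    intro i
    simp [shiftMatrix]
  rw [Matrix.trace, Finset.sum_congr rfl fun i _ => this i,
    Fin.sum_univ_eq_sum_range (fun i => rowEigenvalue l1 l2 i), sum_range_two_mul]
  simp [rowEigenvalue, mul_add]

theorem hasDerivAt_column_T (h1 : l1 ≠ 0) (h2 : l2 ≠ 0) (j : ℕ) (X T : ℂ) :
    HasDerivAt (fun t => column N l1 l2 j X t) (dispersion j • column N l1 l2 (j + 2) X T) T := by
  refine hasDerivAt_pi.2 fun i => ?_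
  have hs : ContDiffOn ℂ ∞ (fun p : ℂ × ℂ => entryW X p.1 i j p.2) {p | p.2 ≠ 0} :=
    (contDiffOn_entryW i j).comp
      (g := fun p : (ℂ × ℂ) × ℂ => entryW p.1.1 p.1.2 i j p.2)
      (f := fun p : ℂ × ℂ => ((X, p.1), p.2)) (by fun_prop) fun p hp => hp
  have h := hasDerivAt_iteratedDeriv (isOpen_snd_ne_zero _) hs ((i : ℕ) / 2)
    (t := T) (z := rowEigenvalue l1 l2 i) (rowEigenvalue_ne_zero h1 h2 i)
  simp only [(hasDerivAt_entryW_T X T i j _).deriv, iteratedDeriv_const_mul_field] at h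
  exact h

theorem hasDerivAt_column_X (h1 : l1 ≠ 0) (h2 : l2 ≠ 0) (j : ℕ) (X T : ℂ) :
    HasDerivAt (fun x => column N l1 l2 (j + 2) x T)
      ((dispersion j / 2) • column N l1 l2 j X T) X := by
  refine hasDerivAt_pi.2 fun i => ?_
  have hs : ContDiffOn ℂ ∞ (fun p : ℂ × ℂ => entryW p.1 T i (j + 2) p.2) {p | p.2 ≠ 0} :=
    (contDiffOn_entryW i (j + 2)).comp
      (g := fun p : (ℂ × ℂ) × ℂ => entryW p.1.1 p.1.2 i (j + 2) p.2)
      (f := fun p : ℂ × ℂ => ((p.1, T), p.2)) (by fun_prop) fun p hp => hp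
  have hl := rowEigenvalue_ne_zero h1 h2 i
  have h := hasDerivAt_iteratedDeriv (isOpen_snd_ne_zero _) hs ((i : ℕ) / 2)
    (t := X) (z := rowEigenvalue l1 l2 i) hl
  refine h.congr_deriv ?_
  have e : (fun z => deriv (fun x => entryW x T i (j + 2) z) X) =ᶠ[𝓝 (rowEigenvalue l1 l2 i)]
      fun z => dispersion j / 2 * entryW X T i j z := by
    filter_upwards [isOpen_ne.mem_nhds hl] with z hz
    exact (hasDerivAt_entryW_X X T i j hz).deriv
  rw [e.iteratedDeriv_eq, iteratedDeriv_const_mul_field]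
  rfl

theorem column_neg_even (k : ℕ) (X T : ℂ) (i : Fin (2 * N)) :
    column N l1 l2 (2 * k) (-X) (-T) i = rowSign i * column N l1 l2 (2 * k + 1) X T i := by
  simp only [column, ← iteratedDeriv_const_mul_field]
  congr 1
  funext l
  exact entryW_neg_even X T i k l

theorem column_neg_odd (k : ℕ) (X T : ℂ) (i : Fin (2 * N)) :
    column N l1 l2 (2 * k + 1) (-X) (-T) i = rowSign i * column N l1 l2 (2 * k) X T i := by
  simp only [column, ← iteratedDeriv_const_mul_field]
  congr 1
  funext l
  exact entryW_neg_odd X T i k l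

end Columns

/-! ### The coefficients of the Darboux polynomials -/

section Darboux

variable (N : ℕ) (l1 l2 : ℂ)

/-- The matrix whose determinant is `|W'_N|`. -/
def waveMatrix (X T : ℂ) : Matrix (Fin (2 * N)) (Fin (2 * N)) ℂ :=
  Matrix.of fun i j => column N l1 l2 j X T i

/-- By Cramer's rule, the coefficients `y_j` in `w_(2N+s) + ∑ y_j w_j = 0`, where `w_j` are the
columns and `j < 2N`; the coefficients with `j ≥ 2N` are zero by convention. For `s = 0, 1` these
are the coefficients of the two rows of the Darboux matrix. -/
def coeff (s j : ℕ) (X T : ℂ) : ℂ :=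
  if h : j < 2 * N then
    -((waveMatrix N l1 l2 X T).cramer (column N l1 l2 (2 * N + s) X T) ⟨j, h⟩)
      / positonW N l1 l2 X T
  else 0

theorem det_waveMatrix (X T : ℂ) : (waveMatrix N l1 l2 X T).det = positonW N l1 l2 X T := by
  rw [positonW, positonDet_eq]; rfl

variable {N l1 l2}

theorem positonDet_eq_cramer (X T : ℂ) {e : ℕ → ℕ → ℂ → ℂ} {n s : ℕ} (hn : n < 2 * N)
    (he : ∀ i j, e i j = if j = n then entryW X T i (2 * N + s) else entryW X T i j) :
    positonDet N e l1 l2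
      = (waveMatrix N l1 l2 X T).cramer (column N l1 l2 (2 * N + s) X T) ⟨n, hn⟩ := by
  rw [positonDet_eq, Matrix.cramer_apply]
  congr 1
  ext i j
  rw [Matrix.updateCol_apply]
  simp only [Matrix.of_apply, he, Fin.ext_iff]
  split_ifs <;> rfl

theorem entry11_eq (hN : 1 ≤ N) (X T : ℂ) (i j : ℕ) :
    entry11 N X T i j = if j = 2 * N - 2 then entryW X T i (2 * N + 0) else entryW X T i j := by
  have : j + 2 = 2 * N ↔ j = 2 * N - 2 := by omega
  funext l
  simp only [entry11, this]
  split_ifs <;> simp [entryW]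

theorem entry12_eq (hN : 1 ≤ N) (X T : ℂ) (i j : ℕ) :
    entry12 N X T i j = if j = 2 * N - 1 then entryW X T i (2 * N + 0) else entryW X T i j := by
  have : j + 1 = 2 * N ↔ j = 2 * N - 1 := by omega
  funext l
  simp only [entry12, this]
  split_ifs <;> simp [entryW]

theorem entry21_eq (hN : 1 ≤ N) (X T : ℂ) (i j : ℕ) :
    entry21 N X T i j = if j = 2 * N - 2 then entryW X T i (2 * N + 1) else entryW X T i j := by
  have : j + 2 = 2 * N ↔ j = 2 * N - 2 := by omega
  have h2 : (2 * N + 1) / 2 = N := by omega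
  funext l
  simp only [entry21, this]
  split_ifs <;> simp [entryW, h2]

theorem positonX_eq (hN : 1 ≤ N) (X T : ℂ) :
    positonX N l1 l2 X T = X + 2 * Complex.I * coeff N l1 l2 0 (2 * N - 2) X T := by
  rw [positonX, positonDet_eq_cramer X T (by omega) (entry11_eq hN X T), coeff, dif_pos]

theorem positonQ_eq (hN : 1 ≤ N) (X T : ℂ) :
    positonQ N l1 l2 X T = 2 * Complex.I * coeff N l1 l2 0 (2 * N - 1) X T := by
  rw [positonQ, positonDet_eq_cramer X T (by omega) (entry12_eq hN X T), coeff, dif_pos]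

theorem positonR_eq (hN : 1 ≤ N) (X T : ℂ) :
    positonR N l1 l2 X T = -(2 * Complex.I) * coeff N l1 l2 1 (2 * N - 2) X T := by
  rw [positonR, positonDet_eq_cramer X T (by omega) (entry21_eq hN X T), coeff, dif_pos]

theorem waveMatrix_mulVec (f : ℕ → ℂ) (X T : ℂ) :
    (waveMatrix N l1 l2 X T).mulVec (fun j => f j)
      = ∑ j ∈ Finset.range (2 * N), f j • column N l1 l2 j X T := by
  rw [← Fin.sum_univ_eq_sum_range (fun j => f j • column N l1 l2 j X T)]
  funext i
  simp [Matrix.mulVec, dotProduct, waveMatrix, mul_comm]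

/-- The defining relations of the Darboux coefficients. -/
theorem coeff_relation {X T : ℂ} (hD : positonW N l1 l2 X T ≠ 0) (s : ℕ) :
    column N l1 l2 (2 * N + s) X T
      + ∑ j ∈ Finset.range (2 * N), coeff N l1 l2 s j X T • column N l1 l2 j X T = 0 := by
  have h := Matrix.mulVec_cramer (waveMatrix N l1 l2 X T) (column N l1 l2 (2 * N + s) X T)
  rw [← waveMatrix_mulVec (fun j => coeff N l1 l2 s j X T)]
  have e : (fun j : Fin (2 * N) => coeff N l1 l2 s j X T) = (-(positonW N l1 l2 X T)⁻¹) •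
      (waveMatrix N l1 l2 X T).cramer (column N l1 l2 (2 * N + s) X T) := by
    funext j
    simp only [coeff, j.2, dif_pos, Pi.smul_apply, smul_eq_mul]
    ring
  rw [e, Matrix.mulVec_smul, h, det_waveMatrix, smul_smul, neg_mul, inv_mul_cancel₀ hD]
  simp

theorem eq_zero_of_sum_column {X T : ℂ} (hD : positonW N l1 l2 X T ≠ 0) {f : ℕ → ℂ}
    (h : ∑ j ∈ Finset.range (2 * N), f j • column N l1 l2 j X T = 0) {j : ℕ} (hj : j < 2 * N) :
    f j = 0 := by
  rw [← waveMatrix_mulVec] at h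
  exact congrFun (Matrix.eq_zero_of_mulVec_eq_zero (by rwa [det_waveMatrix]) h) ⟨j, hj⟩

theorem positonW_ne_zero_of_independent {X T : ℂ}
    (h : ∀ f : ℕ → ℂ, ∑ j ∈ Finset.range (2 * N), f j • column N l1 l2 j X T = 0 →
      ∀ j < 2 * N, f j = 0) : positonW N l1 l2 X T ≠ 0 := by
  rw [← det_waveMatrix]
  intro h0
  obtain ⟨v, hv, hv0⟩ := Matrix.exists_mulVec_eq_zero_iff.2 h0
  apply hv
  set f : ℕ → ℂ := fun n => if hn : n < 2 * N then v ⟨n, hn⟩ else 0 with hf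
  have e : v = fun j : Fin (2 * N) => f j := by
    funext j; simp [hf]
  rw [e, waveMatrix_mulVec] at hv0
  funext j
  rw [e]
  exact h f hv0 j j.2

theorem sum_range_two_mul_succ {M : Type*} [AddCommMonoid M] (f : ℕ → M) (K : ℕ) :
    ∑ j ∈ Finset.range (2 * (K + 1)), f j
      = ∑ j ∈ Finset.range (2 * K), f j + f (2 * K) + f (2 * K + 1) := by
  rw [Nat.mul_succ, Finset.sum_range_succ, Finset.sum_range_succ]

theorem sum_range_two_mul_succ' {M : Type*} [AddCommMonoid M] (f : ℕ → M) (K : ℕ) :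
    ∑ j ∈ Finset.range (2 * (K + 1)), f j
      = ∑ j ∈ Finset.range (2 * K), f (j + 2) + f 1 + f 0 := by
  rw [Nat.mul_succ, Finset.sum_range_succ', Finset.sum_range_succ']

/-- Multiplication by `λ` in the basis of the columns: it shifts coefficients by two places, and the
two columns which leave the basis are expanded by `coeff_relation`. -/
theorem sum_smul_column_add_two (hN : 1 ≤ N) {X T : ℂ} (hD : positonW N l1 l2 X T ≠ 0)
    (f : ℕ → ℂ) :
    ∑ j ∈ Finset.range (2 * N), f j • column N l1 l2 (j + 2) X T
      = ∑ j ∈ Finset.range (2 * N), ((if 2 ≤ j then f (j - 2) else 0)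
          - f (2 * N - 2) * coeff N l1 l2 0 j X T - f (2 * N - 1) * coeff N l1 l2 1 j X T)
            • column N l1 l2 j X T := by
  have h0 := coeff_relation hD 0
  have h1 := coeff_relation hD 1
  simp only [sub_smul, mul_smul, Finset.sum_sub_distrib, ← Finset.smul_sum]
  rw [eq_neg_of_add_eq_zero_right h0, eq_neg_of_add_eq_zero_right h1]
  obtain ⟨K, rfl⟩ : ∃ K, N = K + 1 := ⟨N - 1, by omega⟩
  have e1 : 2 * (K + 1) - 2 = 2 * K := by omega
  have e2 : 2 * (K + 1) - 1 = 2 * K + 1 := by omega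
  rw [e1, e2]
  rw [sum_range_two_mul_succ, sum_range_two_mul_succ' (fun j => ite _ _ _ • _)]
  simp
  rfl

theorem contDiff_det {E : Type*} [NormedAddCommGroup E] [NormedSpace ℂ E] {n : ℕ}
    {A : E → Matrix (Fin n) (Fin n) ℂ} (hA : ∀ i j, ContDiff ℂ ∞ fun p => A p i j) :
    ContDiff ℂ ∞ fun p => (A p).det := by
  simp only [Matrix.det_apply]
  exact ContDiff.sum fun σ _ => (contDiff_prod fun i _ => hA _ _).const_smul _

theorem dispersion_two_mul_add (N s : ℕ) : dispersion (2 * N + s) = dispersion s := by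
  simp [dispersion, Nat.even_add]

theorem contDiff_positonW (h1 : l1 ≠ 0) (h2 : l2 ≠ 0) :
    ContDiff ℂ ∞ fun p : ℂ × ℂ => positonW N l1 l2 p.1 p.2 := by
  simp only [← det_waveMatrix]
  exact contDiff_det fun i j => contDiff_pi.1 (contDiff_column N h1 h2 j) i

theorem isOpen_regularSet (h1 : l1 ≠ 0) (h2 : l2 ≠ 0) : IsOpen (regularSet N l1 l2) :=
  isOpen_ne.preimage (contDiff_positonW h1 h2).continuous

theorem contDiffOn_coeff (h1 : l1 ≠ 0) (h2 : l2 ≠ 0) (s j : ℕ) :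
    ContDiffOn ℂ ∞ (fun p : ℂ × ℂ => coeff N l1 l2 s j p.1 p.2) (regularSet N l1 l2) := by
  unfold coeff
  split_ifs with h
  · refine ContDiffOn.div (ContDiff.contDiffOn ?_) (contDiff_positonW h1 h2).contDiffOn
      fun p hp => hp
    simp only [Matrix.cramer_apply]
    refine (contDiff_det fun i j => ?_).neg
    simp only [Matrix.updateCol_apply]
    split_ifs
    · exact contDiff_pi.1 (contDiff_column N h1 h2 _) i
    · exact contDiff_pi.1 (contDiff_column N h1 h2 j) i
  · exact contDiffOn_const

theorem hasDerivAt_coeff_T (h1 : l1 ≠ 0) (h2 : l2 ≠ 0) {X T : ℂ} (hD : (X, T) ∈ regularSet N l1 l2) (s j : ℕ) :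
    HasDerivAt (fun t => coeff N l1 l2 s j X t) (deriv (fun t => coeff N l1 l2 s j X t) T) T :=
  (ContDiffOn.differentiableAt_snd (isOpen_regularSet h1 h2)
    (contDiffOn_coeff h1 h2 s j) hD).hasDerivAt

theorem hasDerivAt_coeff_X (h1 : l1 ≠ 0) (h2 : l2 ≠ 0) {X T : ℂ} (hD : (X, T) ∈ regularSet N l1 l2) (s j : ℕ) :
    HasDerivAt (fun x => coeff N l1 l2 s j x T) (deriv (fun x => coeff N l1 l2 s j x T) X) X :=
  (ContDiffOn.differentiableAt_fst (isOpen_regularSet h1 h2)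
    (contDiffOn_coeff h1 h2 s j) hD).hasDerivAt

/-- The relations between the columns, multiplied by `λ`. -/
theorem coeff_relation_add_two (h1 : l1 ≠ 0) (h2 : l2 ≠ 0) {X T : ℂ} (hD : (X, T) ∈ regularSet N l1 l2) (s : ℕ) :
    column N l1 l2 (2 * N + s + 2) X T
      + ∑ j ∈ Finset.range (2 * N), coeff N l1 l2 s j X T • column N l1 l2 (j + 2) X T = 0 := by
  have h := congrArg (shiftMatrix N l1 l2).mulVec (coeff_relation hD s)
  simpa only [Matrix.mulVec_add, Matrix.mulVec_sum, Matrix.mulVec_smul, Matrix.mulVec_zero,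
    shiftMatrix_mulVec_column N h1 h2] using h

/-- The `T`-part of the Lax pair, in coefficients. -/
theorem deriv_T_coeff (h1 : l1 ≠ 0) (h2 : l2 ≠ 0) (hN : 1 ≤ N) {X T : ℂ} (hD : (X, T) ∈ regularSet N l1 l2) (s : ℕ) {j : ℕ}
    (hj : j < 2 * N) :
    deriv (fun t => coeff N l1 l2 s j X t) T
      + ((if 2 ≤ j then (dispersion (j - 2) - dispersion s) * coeff N l1 l2 s (j - 2) X T else 0)
        - (dispersion (2 * N - 2) - dispersion s) * coeff N l1 l2 s (2 * N - 2) X T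
          * coeff N l1 l2 0 j X T
        - (dispersion (2 * N - 1) - dispersion s) * coeff N l1 l2 s (2 * N - 1) X T
          * coeff N l1 l2 1 j X T) = 0 := by
  have hd := (hasDerivAt_column_T N h1 h2 (2 * N + s) X T).add
    (HasDerivAt.fun_sum (u := Finset.range (2 * N)) fun j _ =>
      (hasDerivAt_coeff_T h1 h2 hD s j).fun_smul (hasDerivAt_column_T N h1 h2 j X T))
  have e : ((fun t => column N l1 l2 (2 * N + s) X t) + fun t => ∑ j ∈ Finset.range (2 * N),
      coeff N l1 l2 s j X t • column N l1 l2 j X t) =ᶠ[𝓝 T] fun _ => 0 := by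
    filter_upwards [eventually_snd_mem (isOpen_regularSet h1 h2) hD] with t ht
    exact coeff_relation ht s
  have h0 := hd.unique ((hasDerivAt_const T (0 : Fin (2 * N) → ℂ)).congr_of_eventuallyEq e)
  have hr := sum_smul_column_add_two hN hD
    fun j => (dispersion j - dispersion s) * coeff N l1 l2 s j X T
  have h3 := coeff_relation_add_two h1 h2 hD s
  rw [dispersion_two_mul_add, Finset.sum_add_distrib] at h0
  have h4 : ∑ j ∈ Finset.range (2 * N), ((dispersion j - dispersion s) * coeff N l1 l2 s j X T)
        • column N l1 l2 (j + 2) X T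
      = ∑ j ∈ Finset.range (2 * N), coeff N l1 l2 s j X T • dispersion j
          • column N l1 l2 (j + 2) X T
        - dispersion s • ∑ j ∈ Finset.range (2 * N), coeff N l1 l2 s j X T
          • column N l1 l2 (j + 2) X T := by
    rw [Finset.smul_sum, ← Finset.sum_sub_distrib]
    refine Finset.sum_congr rfl fun j _ => ?_
    module
  rw [h4, eq_neg_of_add_eq_zero_right h3] at hr
  refine eq_zero_of_sum_column (f := fun j => deriv (fun t => coeff N l1 l2 s j X t) T
    + ((if 2 ≤ j then (dispersion (j - 2) - dispersion s) * coeff N l1 l2 s (j - 2) X T else 0)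
        - (dispersion (2 * N - 2) - dispersion s) * coeff N l1 l2 s (2 * N - 2) X T
          * coeff N l1 l2 0 j X T
        - (dispersion (2 * N - 1) - dispersion s) * coeff N l1 l2 s (2 * N - 1) X T
          * coeff N l1 l2 1 j X T)) hD ?_ hj
  simp only [add_smul _ _ (column N l1 l2 _ X T)]
  rw [Finset.sum_add_distrib, ← hr, ← h0]
  module

/-- The `X`-part of the Lax pair, in coefficients. -/
theorem deriv_X_coeff (h1 : l1 ≠ 0) (h2 : l2 ≠ 0) (hN : 1 ≤ N) {X T : ℂ} (hD : (X, T) ∈ regularSet N l1 l2) (s : ℕ) {j : ℕ}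
    (hj : j < 2 * N) :
    (dispersion j - dispersion s) / 2 * coeff N l1 l2 s j X T
      + ((if 2 ≤ j then deriv (fun x => coeff N l1 l2 s (j - 2) x T) X else 0)
        - deriv (fun x => coeff N l1 l2 s (2 * N - 2) x T) X * coeff N l1 l2 0 j X T
        - deriv (fun x => coeff N l1 l2 s (2 * N - 1) x T) X * coeff N l1 l2 1 j X T) = 0 := by
  have hd := (hasDerivAt_column_X N h1 h2 (2 * N + s) X T).add
    (HasDerivAt.fun_sum (u := Finset.range (2 * N)) fun j _ =>
      (hasDerivAt_coeff_X h1 h2 hD s j).fun_smul (hasDerivAt_column_X N h1 h2 j X T))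
  have e : ((fun x => column N l1 l2 (2 * N + s + 2) x T) + fun x => ∑ j ∈ Finset.range (2 * N),
      coeff N l1 l2 s j x T • column N l1 l2 (j + 2) x T) =ᶠ[𝓝 X] fun _ => 0 := by
    filter_upwards [eventually_fst_mem (isOpen_regularSet h1 h2) hD] with x hx
    exact coeff_relation_add_two h1 h2 hx s
  have h0 := hd.unique ((hasDerivAt_const X (0 : Fin (2 * N) → ℂ)).congr_of_eventuallyEq e)
  have hr := sum_smul_column_add_two hN hD
    fun j => deriv (fun x => coeff N l1 l2 s j x T) X
  have h3 := coeff_relation hD s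
  rw [dispersion_two_mul_add, Finset.sum_add_distrib, hr] at h0
  have h4 : ∑ j ∈ Finset.range (2 * N), ((dispersion j - dispersion s) / 2
        * coeff N l1 l2 s j X T) • column N l1 l2 j X T
      = ∑ j ∈ Finset.range (2 * N), coeff N l1 l2 s j X T • (dispersion j / 2)
          • column N l1 l2 j X T
        - (dispersion s / 2) • ∑ j ∈ Finset.range (2 * N), coeff N l1 l2 s j X T
          • column N l1 l2 j X T := by
    rw [Finset.smul_sum, ← Finset.sum_sub_distrib]
    refine Finset.sum_congr rfl fun j _ => ?_
    module
  rw [eq_neg_of_add_eq_zero_right h3] at h4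
  refine eq_zero_of_sum_column (f := fun j => (dispersion j - dispersion s) / 2
      * coeff N l1 l2 s j X T
      + ((if 2 ≤ j then deriv (fun x => coeff N l1 l2 s (j - 2) x T) X else 0)
        - deriv (fun x => coeff N l1 l2 s (2 * N - 2) x T) X * coeff N l1 l2 0 j X T
        - deriv (fun x => coeff N l1 l2 s (2 * N - 1) x T) X * coeff N l1 l2 1 j X T)) hD ?_ hj
  simp only [add_smul _ _ (column N l1 l2 _ X T)]
  rw [Finset.sum_add_distrib, h4, ← h0]
  module

/-- Invertibility of `λ` makes the constant terms of the first row of the Darboux matrix not both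
zero: otherwise the row could be divided by `λ`. -/
theorem coeff_zero_or_one_ne_zero (h1 : l1 ≠ 0) (h2 : l2 ≠ 0) (hN : 1 ≤ N) {X T : ℂ} (hD : (X, T) ∈ regularSet N l1 l2) :
    coeff N l1 l2 0 0 X T ≠ 0 ∨ coeff N l1 l2 0 1 X T ≠ 0 := by
  by_contra! hc
  have h := coeff_relation hD 0
  obtain ⟨K, rfl⟩ : ∃ K, N = K + 1 := ⟨N - 1, by omega⟩
  rw [sum_range_two_mul_succ'] at h
  simp only [hc.1, hc.2] at h
  simp only [zero_smul, add_zero] at h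
  change column (K + 1) l1 l2 (2 * K + 2) X T + _ = 0 at h
  have h' : column (K + 1) l1 l2 (2 * K) X T
      + ∑ j ∈ Finset.range (2 * K), coeff (K + 1) l1 l2 0 (j + 2) X T
        • column (K + 1) l1 l2 j X T = 0 := by
    apply shiftMatrix_mulVec_eq_zero (K + 1) h1 h2
    simpa only [Matrix.mulVec_add, Matrix.mulVec_sum, Matrix.mulVec_smul,
      shiftMatrix_mulVec_column (K + 1) h1 h2] using h
  -- the divided relation has coefficient `1` at `λ^(N-1) φ` but involves only basis columns
  have h3 := eq_zero_of_sum_column (f := fun j => if j < 2 * K then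
    coeff (K + 1) l1 l2 0 (j + 2) X T else if j = 2 * K then 1 else 0) hD (j := 2 * K) ?_
    (by omega)
  · simp at h3
  · rw [sum_range_two_mul_succ, ← h', add_comm (column _ _ _ _ _ _)]
    simp only [lt_irrefl, if_false, if_true, one_smul, Nat.succ_ne_self, zero_smul, add_zero,
      not_lt_of_gt (Nat.lt_succ_self _), add_left_inj]
    refine Finset.sum_congr rfl fun j hj => ?_
    rw [if_pos (Finset.mem_range.1 hj)]

/-- The coefficients of `λ^(N-1)` on the diagonal of the Darboux matrix: their sum is minus the
trace of multiplication by `λ`. -/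
theorem coeff_add_coeff (h1 : l1 ≠ 0) (h2 : l2 ≠ 0) (hN : 1 ≤ N) {X T : ℂ} (hD : (X, T) ∈ regularSet N l1 l2) :
    coeff N l1 l2 0 (2 * N - 2) X T + coeff N l1 l2 1 (2 * N - 1) X T = -(N * (l1 + l2)) := by
  -- the block companion matrix of multiplication by `λ` in the basis of the columns
  set c : ℕ → ℕ → ℂ := fun j k => if k + 2 < 2 * N then (if j = k + 2 then 1 else 0)
    else -coeff N l1 l2 (k + 2 - 2 * N) j X T with hc
  set C : Matrix (Fin (2 * N)) (Fin (2 * N)) ℂ := Matrix.of fun j k => c j k with hC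
  have hW : IsUnit (waveMatrix N l1 l2 X T).det := by
    rw [det_waveMatrix]; exact isUnit_iff_ne_zero.2 hD
  have hJ : shiftMatrix N l1 l2 * waveMatrix N l1 l2 X T = waveMatrix N l1 l2 X T * C := by
    ext i k
    have e1 : (shiftMatrix N l1 l2 * waveMatrix N l1 l2 X T) i k
        = (shiftMatrix N l1 l2).mulVec (column N l1 l2 k X T) i := rfl
    have e2 : (waveMatrix N l1 l2 X T * C) i k
        = (waveMatrix N l1 l2 X T).mulVec (fun j => c j k) i := rfl
    rw [e1, e2, shiftMatrix_mulVec_column N h1 h2, waveMatrix_mulVec fun j => c j k]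
    refine congrFun ?_ i
    by_cases hk : (k : ℕ) + 2 < 2 * N
    · simp [hc, hk]
    · have h := coeff_relation hD (k + 2 - 2 * N)
      rw [show 2 * N + ((k : ℕ) + 2 - 2 * N) = k + 2 by omega] at h
      simp only [hc, hk, if_false, neg_smul, Finset.sum_neg_distrib]
      exact eq_neg_of_add_eq_zero_left h
  have ht : (shiftMatrix N l1 l2).trace = C.trace := by
    rw [← Matrix.mul_nonsing_inv_cancel_right _ (shiftMatrix N l1 l2) hW, hJ, Matrix.mul_assoc,
      Matrix.trace_mul_comm, Matrix.nonsing_inv_mul_cancel_right _ _ hW]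
  have hCt : C.trace = ∑ k ∈ Finset.range (2 * N), c k k :=
    Fin.sum_univ_eq_sum_range (fun k => c k k) (2 * N)
  rw [trace_shiftMatrix, hCt] at ht
  rw [ht]
  obtain ⟨K, rfl⟩ : ∃ K, N = K + 1 := ⟨N - 1, by omega⟩
  rw [sum_range_two_mul_succ, Finset.sum_eq_zero]
  · simp [hc, Nat.mul_succ, neg_add_eq_sub]
  · intro k hk
    have := Finset.mem_range.1 hk
    simp only [hc]
    rw [if_pos (by omega), if_neg (by omega)]

end Darboux

/-! ### The hodograph system -/

section HodographSystem

variable {N : ℕ} {l1 l2 : ℂ}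

/-- The reflection `(X, T) ↦ (-X, -T)` exchanges the two kinds of columns. -/
theorem sum_smul_column_neg (f : ℕ → ℂ) (X T : ℂ) (i : Fin (2 * N)) :
    (∑ j ∈ Finset.range (2 * N), f j • column N l1 l2 j (-X) (-T)) i
      = rowSign i * (∑ j ∈ Finset.range (2 * N),
          (if Even j then f (j + 1) else f (j - 1)) • column N l1 l2 j X T) i := by
  rw [sum_range_two_mul, sum_range_two_mul]
  simp only [Finset.sum_apply, Finset.mul_sum, Pi.add_apply, Pi.smul_apply, smul_eq_mul]
  refine Finset.sum_congr rfl fun k _ => ?_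
  have h : ¬ Even (2 * k + 1) := by simp
  rw [column_neg_even, column_neg_odd, if_pos (even_two_mul k), if_neg h, Nat.add_sub_cancel]
  ring

theorem neg_mem_regularSet {X T : ℂ} (hD : (X, T) ∈ regularSet N l1 l2) :
    (-X, -T) ∈ regularSet N l1 l2 := by
  refine positonW_ne_zero_of_independent fun f hf j hj => ?_
  have h : ∑ j ∈ Finset.range (2 * N), (if Even j then f (j + 1) else f (j - 1))
      • column N l1 l2 j X T = 0 := by
    funext i
    have := congrFun hf i
    rw [sum_smul_column_neg] at this
    refine (mul_eq_zero.1 this).resolve_left fun h0 => ?_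
    simpa [h0] using rowSign_mul_self i
  rcases Nat.even_or_odd' j with ⟨k, rfl | rfl⟩
  · have := eq_zero_of_sum_column
      (f := fun j => if Even j then f (j + 1) else f (j - 1)) hD h (j := 2 * k + 1) (by omega)
    simpa using this
  · have := eq_zero_of_sum_column
      (f := fun j => if Even j then f (j + 1) else f (j - 1)) hD h (j := 2 * k) (by omega)
    simpa using this

/-- The reflection exchanges the two rows of the Darboux matrix. -/
theorem coeff_one_eq {X T : ℂ} (hD : (X, T) ∈ regularSet N l1 l2) {j : ℕ} (hj : j < 2 * N) :
    coeff N l1 l2 1 j X T = if Even j then coeff N l1 l2 0 (j + 1) (-X) (-T)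
      else coeff N l1 l2 0 (j - 1) (-X) (-T) := by
  have h := coeff_relation (neg_mem_regularSet hD) 0
  have h1 := coeff_relation hD 1
  rw [← sub_eq_zero]
  refine eq_zero_of_sum_column (f := fun j => coeff N l1 l2 1 j X T
    - if Even j then coeff N l1 l2 0 (j + 1) (-X) (-T)
      else coeff N l1 l2 0 (j - 1) (-X) (-T)) hD ?_ hj
  simp only [sub_smul, Finset.sum_sub_distrib]
  rw [eq_neg_of_add_eq_zero_right h1]
  funext i
  have hi := congrFun h i
  simp only [Pi.add_apply, Pi.zero_apply] at hi
  rw [sum_smul_column_neg, add_zero, column_neg_even, ← mul_add] at hi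
  have := (mul_eq_zero.1 hi).resolve_left fun h0 => by
    simpa [h0] using rowSign_mul_self i
  simp only [Pi.sub_apply, Pi.neg_apply, Pi.zero_apply]
  linear_combination -this

theorem even_two_mul_sub_two (N : ℕ) : Even (2 * N - 2) :=
  ⟨N - 1, by omega⟩

theorem not_even_two_mul_sub_one (hN : 1 ≤ N) : ¬ Even (2 * N - 1) := by
  rw [Nat.not_even_iff_odd]; exact ⟨N - 1, by omega⟩

theorem positonR_eq_neg (hN : 1 ≤ N) {X T : ℂ} (hD : (X, T) ∈ regularSet N l1 l2) :
    positonR N l1 l2 X T = -positonQ N l1 l2 (-X) (-T) := by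
  rw [positonR_eq hN, positonQ_eq hN, coeff_one_eq hD (by omega), if_pos (even_two_mul_sub_two N),
    show 2 * N - 2 + 1 = 2 * N - 1 by omega]
  ring

/-- The additive constant in `centredX` is the one which makes it odd. -/
theorem centredX_neg (hN : 1 ≤ N) (h1 : l1 ≠ 0) (h2 : l2 ≠ 0) {X T : ℂ}
    (hD : (X, T) ∈ regularSet N l1 l2) :
    centredX N l1 l2 (-X) (-T) = -centredX N l1 l2 X T := by
  have h := coeff_add_coeff h1 h2 hN hD
  rw [coeff_one_eq hD (by omega), if_neg (not_even_two_mul_sub_one hN),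
    show 2 * N - 1 - 1 = 2 * N - 2 by omega] at h
  rw [centredX, centredX, positonX_eq hN, positonX_eq hN]
  linear_combination 2 * Complex.I * h

theorem dispersion_zero : dispersion 0 = -Complex.I := by simp [dispersion]

theorem dispersion_one : dispersion 1 = Complex.I := by simp [dispersion]

theorem dispersion_of_even {j : ℕ} (h : Even j) : dispersion j = -Complex.I := if_pos h

theorem dispersion_of_not_even {j : ℕ} (h : ¬ Even j) : dispersion j = Complex.I := if_neg h

/-- `a_T = 2i b c`, where `a`, `b`, `c`, `d` are the coefficients of `λ^(N-1)`. -/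
theorem deriv_T_a (hN : 1 ≤ N) (h1 : l1 ≠ 0) (h2 : l2 ≠ 0) {X T : ℂ}
    (hD : (X, T) ∈ regularSet N l1 l2) :
    deriv (fun t => coeff N l1 l2 0 (2 * N - 2) X t) T
      = 2 * Complex.I * coeff N l1 l2 0 (2 * N - 1) X T * coeff N l1 l2 1 (2 * N - 2) X T := by
  have h := deriv_T_coeff h1 h2 hN hD 0 (j := 2 * N - 2) (by omega)
  have he : Even (2 * N - 2 - 2) := ⟨N - 2, by omega⟩
  rw [dispersion_zero, dispersion_of_even he, dispersion_of_even (even_two_mul_sub_two N),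
    dispersion_of_not_even (not_even_two_mul_sub_one hN)] at h
  simp only [sub_self, zero_mul, ite_self] at h
  linear_combination h

/-- The coefficient `b'` of `λ^(N-2) ψ` in the first row of the Darboux matrix. There is no such
column for `N = 1`, and the coefficient is zero then. -/
def subCoeff (N : ℕ) (l1 l2 X T : ℂ) : ℂ :=
  if 2 ≤ N then coeff N l1 l2 0 (2 * N - 3) X T else 0

/-- `b_T = 2i (b d - b')`, where `b'` is `subCoeff`. -/
theorem deriv_T_b (hN : 1 ≤ N) (h1 : l1 ≠ 0) (h2 : l2 ≠ 0) {X T : ℂ}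
    (hD : (X, T) ∈ regularSet N l1 l2) :
    deriv (fun t => coeff N l1 l2 0 (2 * N - 1) X t) T
      = 2 * Complex.I * (coeff N l1 l2 0 (2 * N - 1) X T * coeff N l1 l2 1 (2 * N - 1) X T
        - subCoeff N l1 l2 X T) := by
  have h := deriv_T_coeff h1 h2 hN hD 0 (j := 2 * N - 1) (by omega)
  have hc : (2 ≤ 2 * N - 1) ↔ 2 ≤ N := by omega
  rw [dispersion_zero, dispersion_of_even (even_two_mul_sub_two N),
    dispersion_of_not_even (not_even_two_mul_sub_one hN)] at h
  simp only [hc, show 2 * N - 1 - 2 = 2 * N - 3 by omega] at h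
  unfold subCoeff
  split_ifs at h ⊢ with h2N
  · have ho : ¬ Even (2 * N - 3) := by
      rw [Nat.not_even_iff_odd]; exact ⟨N - 2, by omega⟩
    rw [dispersion_of_not_even ho] at h
    linear_combination h
  · linear_combination h

/-- `b'_X = a_X b + b_X d - i b`, where `b'` is `subCoeff`. -/
theorem hasDerivAt_subCoeff_X (hN : 1 ≤ N) (h1 : l1 ≠ 0) (h2 : l2 ≠ 0) {X T : ℂ}
    (hD : (X, T) ∈ regularSet N l1 l2) :
    HasDerivAt (fun x => subCoeff N l1 l2 x T)
      (deriv (fun x => coeff N l1 l2 0 (2 * N - 2) x T) X * coeff N l1 l2 0 (2 * N - 1) X T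
        + deriv (fun x => coeff N l1 l2 0 (2 * N - 1) x T) X * coeff N l1 l2 1 (2 * N - 1) X T
        - Complex.I * coeff N l1 l2 0 (2 * N - 1) X T) X := by
  have h := deriv_X_coeff h1 h2 hN hD 0 (j := 2 * N - 1) (by omega)
  have hc : (2 ≤ 2 * N - 1) ↔ 2 ≤ N := by omega
  rw [dispersion_zero, dispersion_of_not_even (not_even_two_mul_sub_one hN)] at h
  simp only [hc, show 2 * N - 1 - 2 = 2 * N - 3 by omega] at h
  unfold subCoeff
  split_ifs at h ⊢ with h2N
  · refine (hasDerivAt_coeff_X h1 h2 hD 0 (2 * N - 3)).congr_deriv ?_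
    linear_combination h
  · refine (hasDerivAt_const X (0 : ℂ)).congr_deriv ?_
    linear_combination h

/-- `d_X = -a_X`, since `a + d` is constant. -/
theorem deriv_X_d (hN : 1 ≤ N) (h1 : l1 ≠ 0) (h2 : l2 ≠ 0) {X T : ℂ}
    (hD : (X, T) ∈ regularSet N l1 l2) :
    deriv (fun x => coeff N l1 l2 1 (2 * N - 1) x T) X
      = -deriv (fun x => coeff N l1 l2 0 (2 * N - 2) x T) X := by
  have e : (fun x => coeff N l1 l2 1 (2 * N - 1) x T) =ᶠ[𝓝 X]
      fun x => -(N * (l1 + l2)) - coeff N l1 l2 0 (2 * N - 2) x T := by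
    filter_upwards [eventually_fst_mem (isOpen_regularSet h1 h2) hD] with x hx
    linear_combination coeff_add_coeff h1 h2 hN hx
  rw [e.deriv_eq, deriv_const_sub]

/-- The determinant condition `a_X² + b_X c_X = i a_X`, from the value of the Lax pair
at `λ = 0`. -/
theorem sq_deriv_X_a (hN : 1 ≤ N) (h1 : l1 ≠ 0) (h2 : l2 ≠ 0) {X T : ℂ}
    (hD : (X, T) ∈ regularSet N l1 l2) :
    deriv (fun x => coeff N l1 l2 0 (2 * N - 2) x T) X ^ 2
      + deriv (fun x => coeff N l1 l2 0 (2 * N - 1) x T) X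
        * deriv (fun x => coeff N l1 l2 1 (2 * N - 2) x T) X
      = Complex.I * deriv (fun x => coeff N l1 l2 0 (2 * N - 2) x T) X := by
  have e00 := deriv_X_coeff h1 h2 hN hD 0 (j := 0) (by omega)
  have e01 := deriv_X_coeff h1 h2 hN hD 0 (j := 1) (by omega)
  have e10 := deriv_X_coeff h1 h2 hN hD 1 (j := 0) (by omega)
  have e11 := deriv_X_coeff h1 h2 hN hD 1 (j := 1) (by omega)
  rw [dispersion_zero] at e00
  rw [dispersion_one, dispersion_zero] at e01 e10
  rw [dispersion_one] at e11
  rw [deriv_X_d hN h1 h2 hD] at e10 e11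
  simp only [show ¬ (2 ≤ 0) by omega, show ¬ (2 ≤ 1) by omega, if_false] at e00 e01 e10 e11
  generalize deriv (fun x => coeff N l1 l2 0 (2 * N - 2) x T) X = a at *
  generalize deriv (fun x => coeff N l1 l2 0 (2 * N - 1) x T) X = b at *
  generalize deriv (fun x => coeff N l1 l2 1 (2 * N - 2) x T) X = c at *
  -- the relation times either constant term of the first row follows from the equations above
  rcases coeff_zero_or_one_ne_zero h1 h2 hN hD with h0 | h0
  · refine mul_right_cancel₀ h0 ?_
    linear_combination (-(a - Complex.I)) * e00 - b * e10
  · refine mul_right_cancel₀ h0 ?_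
    linear_combination (-a) * e01 - b * e11

theorem contDiffOn_positonX (hN : 1 ≤ N) (h1 : l1 ≠ 0) (h2 : l2 ≠ 0) :
    ContDiffOn ℂ ∞ (fun p : ℂ × ℂ => positonX N l1 l2 p.1 p.2) (regularSet N l1 l2) := by
  simp only [positonX_eq hN]
  exact contDiffOn_fst.add (contDiffOn_const.mul (contDiffOn_coeff h1 h2 _ _))

theorem contDiffOn_positonQ (hN : 1 ≤ N) (h1 : l1 ≠ 0) (h2 : l2 ≠ 0) :
    ContDiffOn ℂ ∞ (fun p : ℂ × ℂ => positonQ N l1 l2 p.1 p.2) (regularSet N l1 l2) := by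
  simp only [positonQ_eq hN]
  exact contDiffOn_const.mul (contDiffOn_coeff h1 h2 _ _)

theorem contDiffOn_positonR (hN : 1 ≤ N) (h1 : l1 ≠ 0) (h2 : l2 ≠ 0) :
    ContDiffOn ℂ ∞ (fun p : ℂ × ℂ => positonR N l1 l2 p.1 p.2) (regularSet N l1 l2) := by
  simp only [positonR_eq hN]
  exact contDiffOn_const.mul (contDiffOn_coeff h1 h2 _ _)

theorem deriv_T_positonX (hN : 1 ≤ N) (h1 : l1 ≠ 0) (h2 : l2 ≠ 0) {X T : ℂ}
    (hD : (X, T) ∈ regularSet N l1 l2) :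
    deriv (fun T' => positonX N l1 l2 X T') T
      = -(positonQ N l1 l2 X T * positonR N l1 l2 X T) := by
  simp only [positonX_eq hN, positonQ_eq hN, positonR_eq hN]
  rw [deriv_const_add, deriv_const_mul_field, deriv_T_a hN h1 h2 hD]
  ring

theorem deriv_X_positonX (hN : 1 ≤ N) (h1 : l1 ≠ 0) (h2 : l2 ≠ 0) {X T : ℂ}
    (hD : (X, T) ∈ regularSet N l1 l2) :
    deriv (fun X' => positonX N l1 l2 X' T) X
      = 1 + 2 * Complex.I * deriv (fun x => coeff N l1 l2 0 (2 * N - 2) x T) X := by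
  simp only [positonX_eq hN]
  exact ((hasDerivAt_id X).add ((hasDerivAt_coeff_X h1 h2 hD _ _).const_mul _)).deriv

/-- `u_XT = -2 u ρ`: differentiate `b_T = 2i (b d - b')` in `X` and eliminate `b'_X` and `d_X`. -/
theorem deriv_T_deriv_X_positonQ (hN : 1 ≤ N) (h1 : l1 ≠ 0) (h2 : l2 ≠ 0) {X T : ℂ}
    (hD : (X, T) ∈ regularSet N l1 l2) :
    deriv (fun T' => deriv (fun X' => positonQ N l1 l2 X' T') X) T
      = -2 * positonQ N l1 l2 X T * deriv (fun X' => positonX N l1 l2 X' T) X := by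
  have hU := isOpen_regularSet (N := N) h1 h2
  have hmix := deriv_deriv_comm hU (contDiffOn_coeff h1 h2 0 (2 * N - 1)) hD
  dsimp only at hmix
  rw [deriv_X_positonX hN h1 h2 hD]
  simp only [positonQ_eq hN, deriv_const_mul_field]
  rw [← hmix]
  have e : (fun X' => deriv (fun T' => coeff N l1 l2 0 (2 * N - 1) X' T') T) =ᶠ[𝓝 X]
      fun x => 2 * Complex.I * (coeff N l1 l2 0 (2 * N - 1) x T
        * coeff N l1 l2 1 (2 * N - 1) x T - subCoeff N l1 l2 x T) := by
    filter_upwards [eventually_fst_mem hU hD] with x hx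
    exact deriv_T_b hN h1 h2 hx
  rw [e.deriv_eq, ((((hasDerivAt_coeff_X h1 h2 hD 0 (2 * N - 1)).fun_mul
    (hasDerivAt_coeff_X h1 h2 hD 1 (2 * N - 1))).fun_sub
      (hasDerivAt_subCoeff_X hN h1 h2 hD)).const_mul (2 * Complex.I)).deriv, deriv_X_d hN h1 h2 hD]
  linear_combination (4 * Complex.I * coeff N l1 l2 0 (2 * N - 1) X T) * Complex.I_sq

theorem solvesHodographSystem_positon (hN : 1 ≤ N) (h1 : l1 ≠ 0) (h2 : l2 ≠ 0) :
    SolvesHodographSystem (regularSet N l1 l2) (positonQ N l1 l2) (positonR N l1 l2)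
      (positonX N l1 l2) where
  isOpen := isOpen_regularSet h1 h2
  smooth_u := contDiffOn_positonQ hN h1 h2
  smooth_v := contDiffOn_positonR hN h1 h2
  smooth_x := contDiffOn_positonX hN h1 h2
  symm _ _ hD := neg_mem_regularSet hD
  reduction _ _ hD := positonR_eq_neg hN hD
  eqn_u _ _ hD := deriv_T_deriv_X_positonQ hN h1 h2 hD
  eqn_rho X T hD := by
    have hU := isOpen_regularSet (N := N) h1 h2
    have hmix := deriv_deriv_comm hU (contDiffOn_positonX hN h1 h2) hD
    dsimp only at hmix
    rw [← hmix]
    have e : (fun X' => deriv (fun T' => positonX N l1 l2 X' T') T) =ᶠ[𝓝 X]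
        fun x => -(positonQ N l1 l2 x T * positonR N l1 l2 x T) := by
      filter_upwards [eventually_fst_mem hU hD] with x hx
      exact deriv_T_positonX hN h1 h2 hx
    rw [e.deriv_eq, deriv.fun_neg]
  constraint X T hD := by
    rw [deriv_X_positonX hN h1 h2 hD]
    simp only [positonQ_eq hN, positonR_eq hN, deriv_const_mul_field]
    have h := sq_deriv_X_a hN h1 h2 hD
    generalize deriv (fun x => coeff N l1 l2 0 (2 * N - 2) x T) X = a at *
    generalize deriv (fun x => coeff N l1 l2 0 (2 * N - 1) x T) X = b at *
    generalize deriv (fun x => coeff N l1 l2 1 (2 * N - 2) x T) X = c at *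
    linear_combination (-4 : ℂ) * h + (4 * a ^ 2 + 4 * b * c) * Complex.I_sq
  hodograph_T _ _ hD := deriv_T_positonX hN h1 h2 hD

theorem deriv_centredX_X (X T : ℂ) :
    deriv (fun X' => centredX N l1 l2 X' T) X = deriv (fun X' => positonX N l1 l2 X' T) X := by
  simp only [centredX, deriv_add_const]

theorem deriv_centredX_T (X T : ℂ) :
    deriv (fun T' => centredX N l1 l2 X T') T = deriv (fun T' => positonX N l1 l2 X T') T := by
  simp only [centredX, deriv_add_const]

theorem contDiffOn_centredX (hN : 1 ≤ N) (h1 : l1 ≠ 0) (h2 : l2 ≠ 0) :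
    ContDiffOn ℂ ∞ (fun p : ℂ × ℂ => centredX N l1 l2 p.1 p.2) (regularSet N l1 l2) :=
  (contDiffOn_positonX hN h1 h2).add contDiffOn_const

theorem solvesRSTParametrically_complex (hN : 1 ≤ N) (h1 : l1 ≠ 0) (h2 : l2 ≠ 0) :
    SolvesRSTParametrically ℂ (regularSet N l1 l2) (positonQ N l1 l2) (positonR N l1 l2)
      (centredX N l1 l2) := by
  refine solvesRSTParametrically_of_system (𝕜 := ℂ) (contDiffOn_positonQ hN h1 h2)
    (contDiffOn_centredX hN h1 h2) (fun X T hD => ?_) (fun X T hD => ?_)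
    (fun X T hD => positonR_eq_neg hN hD) fun X T hD => centredX_neg hN h1 h2 hD
  · rw [deriv_centredX_X]
    exact deriv_T_deriv_X_positonQ hN h1 h2 hD
  · rw [deriv_centredX_T]
    exact deriv_T_positonX hN h1 h2 hD

end HodographSystem

/-! ### Reality for purely imaginary eigenvalues -/

section Reality

open scoped ComplexConjugate

variable {N : ℕ} {l1 l2 : ℂ}

/-- A symmetry of `f` under `z ↦ -conj z`, the reflection in the imaginary axis, passes to the
derivatives of `f`. -/
theorem conj_iteratedDeriv {f : ℂ → ℂ} {s : ℂ} (hf : ∀ z, conj (f (-conj z)) = s * f z) (m : ℕ)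
    (z : ℂ) : conj (iteratedDeriv m f (-conj z)) = s * (-1) ^ m * iteratedDeriv m f z := by
  induction m generalizing f s with
  | zero => simpa using hf z
  | succ m ih =>
    have e : (starRingEnd ℂ) ∘ (fun z => f (-z)) ∘ (starRingEnd ℂ) = fun z => s * f z :=
      funext hf
    have h : ∀ z, conj (deriv f (-conj z)) = -s * deriv f z := by
      intro z
      have h := congrFun (deriv_conj_conj (f := fun z => f (-z))) z
      rw [e, deriv_const_mul_field] at h
      simp only [Function.comp_apply, deriv_comp_neg, map_neg] at h
      linear_combination h
    rw [iteratedDeriv_succ', ih h, pow_succ]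
    ring

theorem conj_dispersion (j : ℕ) : conj (dispersion j) = -dispersion j := by
  unfold dispersion; split_ifs <;> simp

theorem conj_entryW (X T : ℝ) (i j : ℕ) (z : ℂ) :
    conj (entryW X T i j (-conj z)) = (-1) ^ (j / 2) * entryW X T i j z := by
  have h : conj (if Even j then (1 : ℂ) else rowSign i) = if Even j then 1 else rowSign i := by
    unfold rowSign; split_ifs <;> simp
  rw [entryW_eq, entryW_eq, map_mul, map_mul, h, ← Complex.exp_conj]
  simp only [map_mul, map_add, map_div₀, map_pow, map_neg, Complex.conj_conj, Complex.conj_ofReal,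
    conj_dispersion, map_ofNat]
  have h2 : -dispersion j * (X / (2 * -z) + -z * T) = dispersion j * (X / (2 * z) + z * T) := by
    rw [mul_neg 2 z, div_neg]
    ring
  rw [neg_pow z, h2]
  ring

/-- Purely imaginary eigenvalues are fixed by `z ↦ -conj z`. -/
theorem neg_conj_rowEigenvalue (a b : ℝ) (i : ℕ) :
    -conj (rowEigenvalue (Complex.I * a) (Complex.I * b) i)
      = rowEigenvalue (Complex.I * a) (Complex.I * b) i := by
  unfold rowEigenvalue; split_ifs <;> simp

theorem conj_column (a b X T : ℝ) (j : ℕ) (i : Fin (2 * N)) :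
    conj (column N (Complex.I * a) (Complex.I * b) j X T i)
      = (-1) ^ ((i : ℕ) / 2) * ((-1) ^ (j / 2)
        * column N (Complex.I * a) (Complex.I * b) j X T i) := by
  have h := conj_iteratedDeriv (conj_entryW X T i j) ((i : ℕ) / 2)
    (rowEigenvalue (Complex.I * a) (Complex.I * b) i)
  rw [neg_conj_rowEigenvalue] at h
  rw [column, h]
  ring

/-- Purely imaginary eigenvalues make the coefficient of `λ^(N-1)` purely imaginary: conjugation
multiplies the columns by signs. -/
theorem conj_coeff (hN : 1 ≤ N) (a b X T : ℝ) :
    conj (coeff N (Complex.I * a) (Complex.I * b) 0 (2 * N - 2) X T)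
      = -coeff N (Complex.I * a) (Complex.I * b) 0 (2 * N - 2) X T := by
  by_cases hD : positonW N (Complex.I * a) (Complex.I * b) X T = 0
  · -- off the regular set the quotient in `coeff` is zero
    simp [coeff, hD]
  have h := coeff_relation hD 0
  have h0 := eq_zero_of_sum_column (f := fun j =>
    coeff N (Complex.I * a) (Complex.I * b) 0 j X T - (-1) ^ N * ((-1) ^ (j / 2)
      * conj (coeff N (Complex.I * a) (Complex.I * b) 0 j X T))) hD ?_
    (j := 2 * N - 2) (by omega)
  · obtain ⟨K, rfl⟩ : ∃ K, N = K + 1 := ⟨N - 1, by omega⟩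
    have e : (2 * (K + 1) - 2) / 2 = K := by omega
    have e2 : ((-1 : ℂ) ^ K) * (-1) ^ K = 1 := by rw [← mul_pow]; simp
    simp only [e] at h0
    generalize coeff (K + 1) (Complex.I * a) (Complex.I * b) 0 (2 * (K + 1) - 2) X T = y at *
    linear_combination h0 - conj y * e2
  · simp only [sub_smul, Finset.sum_sub_distrib]
    rw [eq_neg_of_add_eq_zero_right h]
    funext i
    have hi := congrArg conj (congrFun h i)
    simp only [Pi.add_apply, Finset.sum_apply, Pi.smul_apply, smul_eq_mul, map_add, map_sum,
      map_mul, conj_column, Pi.zero_apply, map_zero, add_zero,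
      show 2 * N / 2 = N by omega] at hi
    have hs : (-1 : ℂ) ^ ((i : ℕ) / 2) ≠ 0 := by simp
    have e2 : ((-1 : ℂ) ^ N) * (-1) ^ N = 1 := by rw [← mul_pow]; simp
    simp only [mul_left_comm _ ((-1 : ℂ) ^ ((i : ℕ) / 2)), ← Finset.mul_sum, ← mul_add] at hi
    have hi' := (mul_eq_zero.1 hi).resolve_left hs
    simp only [Pi.sub_apply, Pi.neg_apply, Finset.sum_apply, Pi.smul_apply, smul_eq_mul,
      Pi.zero_apply, mul_assoc, ← Finset.mul_sum, add_zero]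
    have e3 : ∀ j, (-1 : ℂ) ^ (j / 2) * (conj (coeff N (Complex.I * a) (Complex.I * b) 0 j X T)
        * column N (Complex.I * a) (Complex.I * b) j X T i)
      = conj (coeff N (Complex.I * a) (Complex.I * b) 0 j X T)
        * ((-1) ^ (j / 2) * column N (Complex.I * a) (Complex.I * b) j X T i) := fun j => by ring
    simp only [e3]
    linear_combination -(-1) ^ N * hi' + e2 * column N (Complex.I * a) (Complex.I * b) (2 * N) X T i

theorem centredX_im (hN : 1 ≤ N) (a b X T : ℝ) :
    (centredX N (Complex.I * a) (Complex.I * b) X T).im = 0 := by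
  rw [← Complex.conj_eq_iff_im, centredX, positonX_eq hN]
  simp only [map_add, map_mul, conj_coeff hN, Complex.conj_I, Complex.conj_ofReal, map_ofNat,
    map_natCast]
  ring

/-- The real derivative of a holomorphic function which is real on the real axis. -/
theorem ofReal_deriv_re {f : ℂ → ℂ} {x : ℝ} (hf : DifferentiableAt ℂ f x)
    (hr : ∀ y : ℝ, (f y).im = 0) :
    ((deriv (fun y : ℝ => (f y).re) x : ℝ) : ℂ) = deriv f x := by
  have h1 := hf.hasDerivAt.real_of_complex
  have h2 := h1.ofReal_comp
  have e : (fun y : ℝ => (((f y).re : ℝ) : ℂ)) = fun y : ℝ => f y :=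
    funext fun y => Complex.ext (by simp) (by simp [hr])
  rw [e] at h2
  rw [h1.deriv]
  exact h2.unique hf.hasDerivAt.comp_ofReal

theorem contDiffOn_comp_ofReal {f : ℂ × ℂ → ℂ} {U : Set (ℂ × ℂ)} (hf : ContDiffOn ℂ ∞ f U) :
    ContDiffOn ℝ ∞ (fun p : ℝ × ℝ => f (p.1, p.2)) {p : ℝ × ℝ | ((p.1 : ℂ), (p.2 : ℂ)) ∈ U} := by
  have h : ContDiff ℝ ∞ (fun p : ℝ × ℝ => ((p.1 : ℂ), (p.2 : ℂ))) :=
    (Complex.ofRealCLM.contDiff.comp contDiff_fst).prodMk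
      (Complex.ofRealCLM.contDiff.comp contDiff_snd)
  exact (hf.restrict_scalars ℝ).comp h.contDiffOn fun p hp => hp

theorem solvesRSTParametrically_real (hN : 1 ≤ N) {a b : ℝ} (h1 : Complex.I * a ≠ 0)
    (h2 : Complex.I * b ≠ 0) :
    SolvesRSTParametrically ℝ
      {p : ℝ × ℝ | ((p.1 : ℂ), (p.2 : ℂ)) ∈ regularSet N (Complex.I * a) (Complex.I * b)}
      (fun X T => positonQ N (Complex.I * a) (Complex.I * b) X T)
      (fun X T => positonR N (Complex.I * a) (Complex.I * b) X T)
      (fun X T => (centredX N (Complex.I * a) (Complex.I * b) X T).re) := by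
  have hU := isOpen_regularSet (N := N) h1 h2
  have hq := contDiffOn_positonQ hN h1 h2
  have hx := contDiffOn_centredX hN h1 h2
  have him := centredX_im hN a b
  refine solvesRSTParametrically_of_system (𝕜 := ℝ) (contDiffOn_comp_ofReal hq)
    (Complex.reCLM.contDiff.comp_contDiffOn (contDiffOn_comp_ofReal hx))
    (fun X T hD => ?_) (fun X T hD => ?_) (fun X T hD => ?_) fun X T hD => ?_
  · have hqX := contDiffOn_deriv_fst hU hq
    have e : (fun T' : ℝ => deriv (fun X' : ℝ =>
        positonQ N (Complex.I * a) (Complex.I * b) X' T') X) =ᶠ[𝓝 T]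
        fun T' : ℝ => deriv (fun X' => positonQ N (Complex.I * a) (Complex.I * b) X' T') X := by
      filter_upwards [Complex.continuous_ofReal.continuousAt.eventually
        (eventually_snd_mem hU hD)] with t ht
      exact (ContDiffOn.differentiableAt_fst hU hq ht).hasDerivAt.comp_ofReal.deriv
    rw [e.deriv_eq, (ContDiffOn.differentiableAt_snd hU hqX hD).hasDerivAt.comp_ofReal.deriv,
      Complex.coe_algebraMap, ofReal_deriv_re (f := fun X' =>
        centredX N (Complex.I * a) (Complex.I * b) X' T)
        (ContDiffOn.differentiableAt_fst hU hx hD) fun y => him y T, deriv_centredX_X]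
    exact deriv_T_deriv_X_positonQ hN h1 h2 hD
  · rw [Complex.coe_algebraMap, ofReal_deriv_re (f := fun T' =>
        centredX N (Complex.I * a) (Complex.I * b) X T')
        (ContDiffOn.differentiableAt_snd hU hx hD) fun y => him X y, deriv_centredX_T]
    exact deriv_T_positonX hN h1 h2 hD
  · simpa using positonR_eq_neg hN hD
  · simpa using congrArg Complex.re (centredX_neg hN h1 h2 hD)

end Reality

/-! ### Regularity at the origin -/

section Origin

variable {N : ℕ} {l1 l2 : ℂ}

theorem iteratedDeriv_polynomial_eval (p : Polynomial ℂ) (m : ℕ) :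
    iteratedDeriv m (fun z => p.eval z) = fun z => ((Polynomial.derivative^[m] p).eval z) := by
  induction m generalizing p with
  | zero => simp
  | succ m ih =>
    have h : deriv (fun z => p.eval z) = fun z => (Polynomial.derivative p).eval z :=
      funext fun z => p.deriv
    rw [iteratedDeriv_succ', Function.iterate_succ_apply, h, ih]

theorem eq_zero_of_iteratedDeriv_eval {p : Polynomial ℂ} (hp : p.degree < N) {l : ℂ}
    (h : ∀ m < N, iteratedDeriv m (fun z => p.eval z) l = 0) : p = 0 := by
  by_contra h0
  have hd : p.natDegree < N := (Polynomial.natDegree_lt_iff_degree_lt h0).2 hp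
  have hr : N - 1 < p.rootMultiplicity l := by
    rw [Polynomial.lt_rootMultiplicity_iff_isRoot_iterate_derivative h0]
    intro m hm
    have := h m (by omega)
    rwa [iteratedDeriv_polynomial_eval] at this
  have hle : p.rootMultiplicity l ≤ p.natDegree := by
    simpa using Polynomial.natDegree_le_of_dvd (Polynomial.pow_rootMultiplicity_dvd p l) h0
  omega

/-- At the origin `φ = 1` and `ψ_i = s_i`, so the sum and the difference of the two polynomials in a
linear relation between the columns have a zero of order `N`, at `λ₁` and at `λ₂`. -/
theorem origin_mem_regularSet (h1 : l1 ≠ 0) (h2 : l2 ≠ 0) :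
    (0, 0) ∈ regularSet N l1 l2 := by
  refine positonW_ne_zero_of_independent fun f hf => ?_
  have key : ∀ s < 2, ∀ k < N, f (2 * k) + rowSign s * f (2 * k + 1) = 0 := by
    intro s hs
    set p : Polynomial ℂ := ∑ k ∈ Finset.range N,
      Polynomial.monomial k (f (2 * k) + rowSign s * f (2 * k + 1)) with hp
    have hp0 : p = 0 := by
      refine eq_zero_of_iteratedDeriv_eval (N := N) (l := rowEigenvalue l1 l2 s) ?_ ?_
      · refine (Polynomial.degree_sum_le _ _).trans_lt ?_
        refine (Finset.sup_lt_iff (WithBot.bot_lt_coe N)).2 fun k hk => ?_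
        exact (Polynomial.degree_monomial_le _ _).trans_lt
          (Nat.cast_lt.2 (Finset.mem_range.1 hk))
      · intro m hm
        have hpar : Even (2 * m + s) ↔ Even s := by simp [Nat.even_add]
        have hm2 : (2 * m + s) / 2 = m := by omega
        have hi := congrFun hf ⟨2 * m + s, by omega⟩
        rw [sum_range_two_mul] at hi
        simp only [Finset.sum_apply, Pi.add_apply, Pi.smul_apply, smul_eq_mul, column, hm2,
          Pi.zero_apply, rowEigenvalue, hpar, entryW_congr hpar] at hi
        have e : (fun z => p.eval z) = fun z => ∑ k ∈ Finset.range N,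
            (f (2 * k) * entryW 0 0 s (2 * k) z + f (2 * k + 1) * entryW 0 0 s (2 * k + 1) z) := by
          funext z
          rw [hp, Polynomial.eval_finsetSum]
          refine Finset.sum_congr rfl fun k _ => ?_
          have h3 : (2 * k + 1) / 2 = k := by omega
          simp only [Polynomial.eval_monomial, entryW_eq, even_two_mul, h3]
          simp
          ring
        have hl := rowEigenvalue_ne_zero h1 h2 s
        have hc : ∀ j, ContDiffAt ℂ m (entryW 0 0 s j) (rowEigenvalue l1 l2 s) := fun j =>
          (contDiffAt_entryW 0 0 s j hl).of_le (WithTop.coe_le_coe.2 le_top)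
        rw [e, iteratedDeriv_fun_sum fun k _ =>
          (contDiffAt_const.mul (hc _)).add (contDiffAt_const.mul (hc _))]
        refine Eq.trans ?_ hi
        refine Finset.sum_congr rfl fun k _ => ?_
        rw [iteratedDeriv_fun_add (contDiffAt_const.mul (hc _)) (contDiffAt_const.mul (hc _)),
          iteratedDeriv_const_mul_field, iteratedDeriv_const_mul_field]
        rfl
    intro k hk
    have := congrArg (fun q => Polynomial.coeff q k) hp0
    simpa only [hp, Polynomial.finsetSum_coeff, Polynomial.coeff_monomial, Finset.sum_ite_eq',
      Finset.mem_range, hk, if_true, Polynomial.coeff_zero] using this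
  intro j hj
  rcases Nat.even_or_odd' j with ⟨k, rfl | rfl⟩
  · have h0 := key 0 (by omega) k (by omega)
    have h1 := key 1 (by omega) k (by omega)
    simp [rowSign] at h0 h1
    linear_combination (h0 + h1) / 2
  · have h0 := key 0 (by omega) k (by omega)
    have h1 := key 1 (by omega) k (by omega)
    simp [rowSign] at h0 h1
    linear_combination (h0 - h1) / 2

end Origin

/-! ### The degenerate limit -/

section DegenerateLimit

section DividedDifference

variable {ι : Type*} [DecidableEq ι]

/-- The divided difference of `f` at the nodes `v k`, `k ∈ s`, as the Lagrange sum
`∑ f(v k) / ∏ (v k - v j)`. -/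
def dividedDifference (s : Finset ι) (v : ι → ℂ) (f : ℂ → ℂ) : ℂ :=
  ∑ k ∈ s, Lagrange.nodalWeight s v k * f (v k)

/-- Partial fractions turn the Cauchy integral formula into one for divided differences. -/
theorem dividedDifference_eq_circleIntegral {s : Finset ι} (hs : s.Nonempty) {v : ι → ℂ}
    (hv : Set.InjOn v s) {f : ℂ → ℂ} {c : ℂ} {r : ℝ} (hf : DiffContOnCl ℂ f (Metric.ball c r))
    (hvr : ∀ k ∈ s, v k ∈ Metric.ball c r) :
    dividedDifference s v f
      = (2 * Real.pi * Complex.I)⁻¹ * circleIntegral (fun z => (∏ k ∈ s, (z - v k))⁻¹ * f z) c r := by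
  obtain ⟨k0, hk0⟩ := hs
  have hr : 0 < r := Metric.pos_of_mem_ball (hvr k0 hk0)
  have hne : ∀ z ∈ Metric.sphere c r, ∀ k ∈ s, z ≠ v k := by
    rintro z hz k hk rfl
    exact (Metric.mem_ball.1 (hvr k hk)).ne (Metric.mem_sphere.1 hz)
  have hcont : ContinuousOn f (Metric.sphere c r) :=
    hf.continuousOn_ball.mono Metric.sphere_subset_closedBall
  have e : Set.EqOn (fun z => (∏ k ∈ s, (z - v k))⁻¹ * f z)
      (fun z => ∑ k ∈ s, Lagrange.nodalWeight s v k * ((z - v k)⁻¹ * f z))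
      (Metric.sphere c r) := by
    intro z hz
    have h := Lagrange.eval_interpolate_not_at_node (s := s) (v := v) 1 (hne z hz)
    rw [Lagrange.interpolate_one hv ⟨k0, hk0⟩, Polynomial.eval_one, Lagrange.eval_nodal] at h
    have h' := inv_eq_of_mul_eq_one_right h.symm
    dsimp only
    rw [h', Finset.sum_mul]
    refine Finset.sum_congr rfl fun k _ => ?_
    simp only [Pi.one_apply]
    ring
  rw [circleIntegral.integral_congr hr.le e, circleIntegral.integral_fun_sum, Finset.mul_sum]
  · refine Finset.sum_congr rfl fun k hk => ?_
    have h := hf.circleIntegral_sub_inv_smul (hvr k hk)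
    simp only [smul_eq_mul] at h
    rw [circleIntegral.integral_const_mul, h, mul_left_comm, inv_mul_cancel_left₀]
    exact Complex.two_pi_I_ne_zero
  · intro k hk
    refine ContinuousOn.circleIntegrable hr.le (continuousOn_const.mul (ContinuousOn.mul ?_ hcont))
    exact (continuousOn_id.sub continuousOn_const).inv₀ fun z hz => sub_ne_zero.2 (hne z hz k hk)

/-- When the nodes collapse to a point, divided differences tend to a derivative. -/
theorem tendsto_dividedDifference [Fintype ι] {s : Finset ι} {m : ℕ} (hs : s.card = m + 1)
    {f : ℂ → ℂ} {c : ℂ} {R : ℝ} (hR : 0 < R) (hf : DifferentiableOn ℂ f (Metric.ball c R))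
    {v₀ : ι → ℂ} (hv₀ : ∀ k ∈ s, v₀ k = c) :
    Filter.Tendsto (fun v => dividedDifference s v f)
      (𝓝[{v : ι → ℂ | Function.Injective v}] v₀) (𝓝 (iteratedDeriv m f c / m.factorial)) := by
  have hsne : s.Nonempty := Finset.card_pos.1 (by omega)
  set r : ℝ := R / 2 with hr
  have hr0 : 0 < r := by positivity
  have hfr : DiffContOnCl ℂ f (Metric.ball c r) :=
    (hf.mono (Metric.closure_ball_subset_closedBall.trans
      (Metric.closedBall_subset_ball (by linarith)))).diffContOnCl
  set K : Set (ι → ℂ) := Metric.closedBall v₀ (r / 2) with hK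
  have hKn : K ∈ 𝓝 v₀ := Metric.closedBall_mem_nhds v₀ (by positivity)
  have hmem : ∀ v ∈ K, ∀ k ∈ s, v k ∈ Metric.ball c r := by
    intro v hv k hk
    have := (dist_le_pi_dist v v₀ k).trans (Metric.mem_closedBall.1 hv)
    rw [hv₀ k hk] at this
    exact Metric.mem_ball.2 (this.trans_lt (by linarith))
  have hcont : ContinuousOn (fun p : (ι → ℂ) × ℂ => (∏ k ∈ s, (p.2 - p.1 k))⁻¹ * f p.2)
      (K ×ˢ Metric.sphere c r) := by
    refine ContinuousOn.mul (ContinuousOn.inv₀ (by fun_prop) ?_) ?_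
    · rintro ⟨v, z⟩ ⟨hv, hz⟩
      refine Finset.prod_ne_zero_iff.2 fun k hk => sub_ne_zero.2 fun hzk : z = v k => ?_
      exact (Metric.mem_ball.1 (hmem v hv k hk)).ne (hzk ▸ Metric.mem_sphere.1 hz)
    · exact (hfr.continuousOn_ball.mono Metric.sphere_subset_closedBall).comp continuousOn_snd
        fun p hp => hp.2
  have hunif := ((isCompact_closedBall v₀ (r / 2)).prod
    (isCompact_sphere c r)).uniformContinuousOn_of_continuous hcont
  have htend : TendstoUniformlyOn (fun (v : ι → ℂ) z => (∏ k ∈ s, (z - v k))⁻¹ * f z)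
      (fun z => (∏ k ∈ s, (z - v₀ k))⁻¹ * f z) (𝓝 v₀) (Metric.sphere c r) := by
    have := hunif.tendstoUniformlyOn (F := fun (v : ι → ℂ) z => (∏ k ∈ s, (z - v k))⁻¹ * f z)
      (mem_of_mem_nhds hKn)
    rwa [nhdsWithin_eq_nhds.2 hKn] at this
  have hint := htend.tendsto_circleIntegral_of_continuousOn hr0.le (by
    filter_upwards [hKn] with v hv
    exact hcont.comp (f := fun z => (v, z)) (by fun_prop) fun z hz => ⟨hv, hz⟩)
  have hlim := (hint.const_mul (2 * Real.pi * Complex.I)⁻¹).mono_left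
    (nhdsWithin_le_nhds (s := {v : ι → ℂ | Function.Injective v}))
  -- at the collapsed nodes the integrand is the one of Cauchy's formula for the `m`-th derivative
  have hval : (2 * Real.pi * Complex.I)⁻¹
      * circleIntegral (fun z => (∏ k ∈ s, (z - v₀ k))⁻¹ * f z) c r
        = iteratedDeriv m f c / m.factorial := by
    have h := DiffContOnCl.circleIntegral_one_div_sub_center_pow_smul hr0 m hfr
    have e : (fun z => (∏ k ∈ s, (z - v₀ k))⁻¹ * f z)
        = fun z => (1 / (z - c) ^ (m + 1)) • f z := by
      funext z
      rw [Finset.prod_congr rfl fun k hk => by rw [hv₀ k hk], Finset.prod_const, hs, one_div,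
        smul_eq_mul]
    rw [e, h, smul_eq_mul]
    have := Complex.two_pi_I_ne_zero
    field_simp
  rw [hval] at hlim
  refine hlim.congr' ?_
  filter_upwards [self_mem_nhdsWithin, mem_nhdsWithin_of_mem_nhds hKn] with v hv hvK
  exact (dividedDifference_eq_circleIntegral hsne hv.injOn hfr (hmem v hvK)).symm

end DividedDifference

variable (N : ℕ)

/-- The rows up to and including `i` which belong to the same eigenvalue as row `i`. -/
def sameRows (i : Fin (2 * N)) : Finset (Fin (2 * N)) :=
  Finset.univ.filter fun k => k ≤ i ∧ (Even (k : ℕ) ↔ Even (i : ℕ))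

/-- Row `i` carries the derivative of order `i / 2`, so a divided difference at `i / 2 + 1` nodes has
to replace it. -/
theorem card_sameRows (i : Fin (2 * N)) : (sameRows N i).card = (i : ℕ) / 2 + 1 := by
  rw [← Finset.card_range ((i : ℕ) / 2 + 1)]
  refine (Finset.card_bij (fun m hm => (⟨2 * m + i % 2, by
    have := Finset.mem_range.1 hm
    omega⟩ : Fin (2 * N))) ?_ ?_ ?_).symm
  · intro m hm
    have := Finset.mem_range.1 hm
    simp only [sameRows, Finset.mem_filter, Finset.mem_univ, true_and, Fin.le_def,
      Nat.even_iff]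
    omega
  · intro m _ m' _ h
    have := congrArg Fin.val h
    dsimp only at this
    omega
  · intro k hk
    simp only [sameRows, Finset.mem_filter, Finset.mem_univ, true_and, Fin.le_def,
      Nat.even_iff] at hk
    exact ⟨(k : ℕ) / 2, Finset.mem_range.2 (by omega), Fin.ext (by dsimp only; omega)⟩

/-- The matrix of the row operations which replace row `i` by the divided difference at the nodes
`sameRows N i`. -/
def rowOperations (Λ : Fin (2 * N) → ℂ) : Matrix (Fin (2 * N)) (Fin (2 * N)) ℂ :=
  Matrix.of fun i k => if k ∈ sameRows N i then Lagrange.nodalWeight (sameRows N i) Λ k else 0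

theorem det_rowOperations_ne_zero {Λ : Fin (2 * N) → ℂ} (hΛ : Function.Injective Λ) :
    (rowOperations N Λ).det ≠ 0 := by
  rw [Matrix.det_of_isLowerTriangular]
  · refine Finset.prod_ne_zero_iff.2 fun i _ => ?_
    have hi : i ∈ sameRows N i := by simp [sameRows]
    simp only [rowOperations, Matrix.of_apply, if_pos hi]
    exact Lagrange.nodalWeight_ne_zero hΛ.injOn hi
  · intro i k hik
    have hk : k ∉ sameRows N i := by
      simp only [sameRows, Finset.mem_filter, Finset.mem_univ, true_and, not_and]
      intro hki
      exact absurd hki (not_le_of_gt hik)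
    simp [rowOperations, hk]

variable {N}

theorem det_rowOperations_mul {e : ℕ → ℕ → ℂ → ℂ}
    (hpar : ∀ {i k : ℕ}, (Even k ↔ Even i) → ∀ j, e k j = e i j) (Λ : Fin (2 * N) → ℂ) :
    (rowOperations N Λ).det * solitonDet N e Λ = Matrix.det (Matrix.of fun i j : Fin (2 * N) =>
      dividedDifference (sameRows N i) Λ (e i j)) := by
  rw [solitonDet, ← Matrix.det_mul]
  congr 1
  ext i j
  simp only [Matrix.mul_apply, rowOperations, Matrix.of_apply, ite_mul, zero_mul,
    dividedDifference, Finset.sum_ite_mem, Finset.univ_inter]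
  refine Finset.sum_congr rfl fun k hk => ?_
  rw [hpar (Finset.mem_filter.1 hk).2.2]

/-- After the row operations, the determinants of the soliton formulas tend to those of the positon
formulas, up to a factor which does not depend on the entries. -/
theorem tendsto_det_rowOperations_mul {e : ℕ → ℕ → ℂ → ℂ}
    (hpar : ∀ {i k : ℕ}, (Even k ↔ Even i) → ∀ j, e k j = e i j)
    (hdiff : ∀ i j l, l ≠ 0 → DifferentiableAt ℂ (e i j) l) {l1 l2 : ℂ} (h1 : l1 ≠ 0)
    (h2 : l2 ≠ 0) :
    Filter.Tendsto (fun Λ => (rowOperations N Λ).det * solitonDet N e Λ)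
      (𝓝[{Λ : Fin (2 * N) → ℂ | Function.Injective Λ}]
        (fun i : Fin (2 * N) => rowEigenvalue l1 l2 i))
      (𝓝 ((∏ i : Fin (2 * N), ((((i : ℕ) / 2).factorial : ℕ) : ℂ)⁻¹) * positonDet N e l1 l2)) := by
  simp only [det_rowOperations_mul hpar]
  rw [positonDet_eq, ← Matrix.det_mul_column]
  refine Filter.Tendsto.comp (Continuous.matrix_det continuous_id).continuousAt.tendsto
    (tendsto_pi_nhds.2 fun i => tendsto_pi_nhds.2 fun j => ?_)
  have hl := rowEigenvalue_ne_zero h1 h2 i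
  have h := tendsto_dividedDifference (card_sameRows N i) (norm_pos_iff.2 hl) (f := e i j)
    (v₀ := fun i : Fin (2 * N) => rowEigenvalue l1 l2 i) (c := rowEigenvalue l1 l2 i) ?_ ?_
  · simpa [div_eq_inv_mul] using h
  · intro z hz
    refine (hdiff i j z ?_).differentiableWithinAt
    rintro rfl
    simp at hz
  · intro k hk
    simp only [rowEigenvalue, (Finset.mem_filter.1 hk).2.2]

theorem tendsto_solitonDet_div {e e' : ℕ → ℕ → ℂ → ℂ}
    (hpar : ∀ {i k : ℕ}, (Even k ↔ Even i) → ∀ j, e k j = e i j)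
    (hdiff : ∀ i j l, l ≠ 0 → DifferentiableAt ℂ (e i j) l)
    (hpar' : ∀ {i k : ℕ}, (Even k ↔ Even i) → ∀ j, e' k j = e' i j)
    (hdiff' : ∀ i j l, l ≠ 0 → DifferentiableAt ℂ (e' i j) l) {l1 l2 : ℂ} (h1 : l1 ≠ 0)
    (h2 : l2 ≠ 0) (hW : positonDet N e' l1 l2 ≠ 0) :
    Filter.Tendsto (fun Λ => -solitonDet N e Λ / solitonDet N e' Λ)
      (𝓝[{Λ : Fin (2 * N) → ℂ | Function.Injective Λ}]
        (fun i : Fin (2 * N) => rowEigenvalue l1 l2 i))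
      (𝓝 (-positonDet N e l1 l2 / positonDet N e' l1 l2)) := by
  have hc : (∏ i : Fin (2 * N), ((((i : ℕ) / 2).factorial : ℕ) : ℂ)⁻¹) ≠ 0 :=
    Finset.prod_ne_zero_iff.2 fun i _ => inv_ne_zero (Nat.cast_ne_zero.2 (Nat.factorial_ne_zero _))
  have h := ((tendsto_det_rowOperations_mul hpar hdiff h1 h2).neg.div
    (tendsto_det_rowOperations_mul hpar' hdiff' h1 h2) (mul_ne_zero hc hW))
  rw [← mul_neg, mul_div_mul_left _ _ hc] at h
  refine h.congr' ?_
  filter_upwards [self_mem_nhdsWithin] with Λ hΛ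
  simp only [Pi.div_apply]
  rw [← mul_neg, mul_div_mul_left _ _ (det_rowOperations_ne_zero N hΛ)]

theorem eventually_solitonDet_ne_zero {e : ℕ → ℕ → ℂ → ℂ}
    (hpar : ∀ {i k : ℕ}, (Even k ↔ Even i) → ∀ j, e k j = e i j)
    (hdiff : ∀ i j l, l ≠ 0 → DifferentiableAt ℂ (e i j) l) {l1 l2 : ℂ} (h1 : l1 ≠ 0)
    (h2 : l2 ≠ 0) (hW : positonDet N e l1 l2 ≠ 0) :
    ∀ᶠ Λ in 𝓝[{Λ : Fin (2 * N) → ℂ | Function.Injective Λ}]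
        (fun i : Fin (2 * N) => rowEigenvalue l1 l2 i), solitonDet N e Λ ≠ 0 := by
  have hc : (∏ i : Fin (2 * N), ((((i : ℕ) / 2).factorial : ℕ) : ℂ)⁻¹) ≠ 0 :=
    Finset.prod_ne_zero_iff.2 fun i _ => inv_ne_zero (Nat.cast_ne_zero.2 (Nat.factorial_ne_zero _))
  filter_upwards [(tendsto_det_rowOperations_mul hpar hdiff h1 h2).eventually_ne
    (mul_ne_zero hc hW)] with Λ hΛ
  exact right_ne_zero_of_mul hΛ

theorem differentiableAt_entryW (X T : ℂ) (i j : ℕ) {l : ℂ} (hl : l ≠ 0) :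
    DifferentiableAt ℂ (entryW X T i j) l :=
  (contDiffAt_entryW X T i j hl).differentiableAt (by simp)

theorem degenerate_limit (hN : 1 ≤ N) {l1 l2 : ℂ} (h1 : l1 ≠ 0) (h2 : l2 ≠ 0) {X T : ℂ}
    (hD : (X, T) ∈ regularSet N l1 l2) :
    (∀ᶠ Λ in 𝓝[{Λ : Fin (2 * N) → ℂ | Function.Injective Λ}]
        (fun i : Fin (2 * N) => rowEigenvalue l1 l2 i), solitonW N Λ X T ≠ 0) ∧
    Filter.Tendsto (fun Λ => solitonQ N Λ X T)
      (𝓝[{Λ : Fin (2 * N) → ℂ | Function.Injective Λ}]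
        (fun i : Fin (2 * N) => rowEigenvalue l1 l2 i)) (𝓝 (positonQ N l1 l2 X T)) ∧
    Filter.Tendsto (fun Λ => solitonR N Λ X T)
      (𝓝[{Λ : Fin (2 * N) → ℂ | Function.Injective Λ}]
        (fun i : Fin (2 * N) => rowEigenvalue l1 l2 i)) (𝓝 (positonR N l1 l2 X T)) ∧
    Filter.Tendsto (fun Λ => solitonX N Λ X T)
      (𝓝[{Λ : Fin (2 * N) → ℂ | Function.Injective Λ}]
        (fun i : Fin (2 * N) => rowEigenvalue l1 l2 i)) (𝓝 (positonX N l1 l2 X T)) := by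
  have hpar : ∀ {i k : ℕ}, (Even k ↔ Even i) → ∀ j, entryW X T k j = entryW X T i j :=
    fun h j => entryW_congr h X T j
  have hdiff : ∀ i j l, l ≠ 0 → DifferentiableAt ℂ (entryW X T i j) l :=
    fun i j l hl => differentiableAt_entryW X T i j hl
  have key : ∀ {e : ℕ → ℕ → ℂ → ℂ} {n m : ℕ},
      (∀ i j, e i j = if j = n then entryW X T i m else entryW X T i j) →
      Filter.Tendsto (fun Λ => -solitonDet N e Λ / solitonDet N (entryW X T) Λ)
        (𝓝[{Λ : Fin (2 * N) → ℂ | Function.Injective Λ}]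
          (fun i : Fin (2 * N) => rowEigenvalue l1 l2 i))
        (𝓝 (-positonDet N e l1 l2 / positonDet N (entryW X T) l1 l2)) := by
    intro e n m he
    refine tendsto_solitonDet_div (fun h j => ?_) (fun i j l hl => ?_) hpar hdiff h1 h2 hD
    · rw [he, he, hpar h, hpar h]
    · rw [he]
      split_ifs <;> exact hdiff _ _ l hl
  exact ⟨eventually_solitonDet_ne_zero hpar hdiff h1 h2 hD,
    (key (entry12_eq hN X T)).const_mul _, (key (entry21_eq hN X T)).const_mul _,
    ((key (entry11_eq hN X T)).const_mul _).const_add _⟩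

end DegenerateLimit

/-! ### The explicit 2-positon -/

section TwoPositon

variable {l1 l2 : ℂ}

theorem det_fin_four {R : Type*} [CommRing R] (A : Matrix (Fin 4) (Fin 4) R) :
    A.det = A 0 0 * (A 1 1 * (A 2 2 * A 3 3 - A 2 3 * A 3 2)
        - A 1 2 * (A 2 1 * A 3 3 - A 2 3 * A 3 1) + A 1 3 * (A 2 1 * A 3 2 - A 2 2 * A 3 1))
      - A 0 1 * (A 1 0 * (A 2 2 * A 3 3 - A 2 3 * A 3 2)
        - A 1 2 * (A 2 0 * A 3 3 - A 2 3 * A 3 0) + A 1 3 * (A 2 0 * A 3 2 - A 2 2 * A 3 0))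
      + A 0 2 * (A 1 0 * (A 2 1 * A 3 3 - A 2 3 * A 3 1)
        - A 1 1 * (A 2 0 * A 3 3 - A 2 3 * A 3 0) + A 1 3 * (A 2 0 * A 3 1 - A 2 1 * A 3 0))
      - A 0 3 * (A 1 0 * (A 2 1 * A 3 2 - A 2 2 * A 3 1)
        - A 1 1 * (A 2 0 * A 3 2 - A 2 2 * A 3 0) + A 1 2 * (A 2 0 * A 3 1 - A 2 1 * A 3 0)) := by
  rw [Matrix.det_succ_row_zero, Fin.sum_univ_four]
  simp only [Matrix.det_fin_three, Matrix.submatrix_apply]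
  simp [Fin.succAbove, Fin.lt_def]
  ring

/-- The logarithmic derivative of `φ` in `λ`. -/
def slope (X T l : ℂ) : ℂ := Complex.I * (X / (2 * l ^ 2) - T)

/-- The derivative of the entries in `λ`. -/
theorem hasDerivAt_entryW (X T : ℂ) (i j : ℕ) {l : ℂ} (hl : l ≠ 0) :
    HasDerivAt (entryW X T i j) (((j / 2 : ℕ) : ℂ) * l ^ (j / 2 - 1)
      * (if Even j then phi X T l else psi i X T l)
        + (if Even j then 1 else -1) * slope X T l * entryW X T i j l) l := by
  have e : entryW X T i j = fun l => (if Even j then 1 else rowSign i) * l ^ (j / 2)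
      * Complex.exp (dispersion j * (X / 2 * l⁻¹ + l * T)) := by
    funext l
    rw [entryW_eq]
    congr 3
    ring
  have h : HasDerivAt (fun l => (if Even j then (1 : ℂ) else rowSign i) * l ^ (j / 2)
      * Complex.exp (dispersion j * (X / 2 * l⁻¹ + l * T))) _ l :=
    ((hasDerivAt_pow (j / 2) l).const_mul _).mul
      ((((hasDerivAt_inv hl).const_mul (X / 2)).fun_add
        ((hasDerivAt_id' l).mul_const T)).const_mul (dispersion j)).cexp
  rw [e]
  refine h.congr_deriv ?_
  have h2 : (if Even j then phi X T l else psi i X T l) = (if Even j then 1 else rowSign i)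
      * Complex.exp (dispersion j * (X / 2 * l⁻¹ + l * T)) := by
    unfold phi psi dispersion rowSign
    split_ifs <;> ring_nf
  have h3 : dispersion j * (X / 2 * -(l ^ 2)⁻¹ + 1 * T)
      = (if Even j then 1 else -1) * slope X T l := by
    unfold dispersion slope
    split_ifs <;> ring
  rw [h2, h3]
  ring

/-- The rows of the columns for `N = 2`: row `0` and row `1` hold values, row `2` and row `3` first
derivatives, and `ψ = φ⁻¹` at `λ₁`, `ψ = -φ⁻¹` at `λ₂`. -/
theorem column_two_zero (j : ℕ) (X T : ℂ) :
    column 2 l1 l2 j X T 0 = l1 ^ (j / 2) * (if Even j then phi X T l1 else (phi X T l1)⁻¹) := by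
  have h : psi 0 X T l1 = (phi X T l1)⁻¹ := by
    unfold psi phi
    rw [← Complex.exp_neg]
    simp
    ring_nf
  simp [column, rowEigenvalue, entryW, h]

theorem column_two_one (j : ℕ) (X T : ℂ) :
    column 2 l1 l2 j X T 1 = l2 ^ (j / 2) * (if Even j then phi X T l2 else -(phi X T l2)⁻¹) := by
  have h : psi 1 X T l2 = -(phi X T l2)⁻¹ := by
    unfold psi phi
    rw [← Complex.exp_neg]
    simp
    ring_nf
  simp [column, rowEigenvalue, entryW, h]

theorem column_two_two (h1 : l1 ≠ 0) (j : ℕ) (X T : ℂ) :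
    column 2 l1 l2 j X T 2 = (((j / 2 : ℕ) : ℂ) * l1 ^ (j / 2 - 1)
      + (if Even j then 1 else -1) * slope X T l1 * l1 ^ (j / 2))
        * (if Even j then phi X T l1 else (phi X T l1)⁻¹) := by
  have h : psi 2 X T l1 = (phi X T l1)⁻¹ := by
    unfold psi phi
    rw [← Complex.exp_neg]
    simp
    ring_nf
  have e : column 2 l1 l2 j X T 2 = deriv (entryW X T 2 j) l1 := by
    change iteratedDeriv 1 (entryW X T 2 j) (rowEigenvalue l1 l2 2) = _
    simp [rowEigenvalue, iteratedDeriv_one]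
  rw [e, (hasDerivAt_entryW X T 2 j h1).deriv, entryW, h]
  ring

theorem column_two_three (h2 : l2 ≠ 0) (j : ℕ) (X T : ℂ) :
    column 2 l1 l2 j X T 3 = (((j / 2 : ℕ) : ℂ) * l2 ^ (j / 2 - 1)
      + (if Even j then 1 else -1) * slope X T l2 * l2 ^ (j / 2))
        * (if Even j then phi X T l2 else -(phi X T l2)⁻¹) := by
  have h : psi 3 X T l2 = -(phi X T l2)⁻¹ := by
    unfold psi phi
    rw [← Complex.exp_neg]
    simp [show ¬ Even 3 by decide]
    ring_nf
  have e : column 2 l1 l2 j X T 3 = deriv (entryW X T 3 j) l2 := by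
    change iteratedDeriv 1 (entryW X T 3 j) (rowEigenvalue l1 l2 3) = _
    simp [rowEigenvalue, iteratedDeriv_one, show ¬ Even 3 by decide]
  rw [e, (hasDerivAt_entryW X T 3 j h2).deriv, entryW, h]
  ring

theorem phi_ne_zero (X T l : ℂ) : phi X T l ≠ 0 := Complex.exp_ne_zero _

/-- `|W'_2|`; the factors `φ₁²` and `φ₂²` are `exp H₁` and `exp H₂`. -/
theorem positonW_two (h1 : l1 ≠ 0) (h2 : l2 ≠ 0) (X T : ℂ) :
    positonW 2 l1 l2 X T = phi X T l1 ^ 2 / phi X T l2 ^ 2 + phi X T l2 ^ 2 / phi X T l1 ^ 2 + 2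
      + 4 * (l1 - l2) ^ 2 * slope X T l1 * slope X T l2 := by
  rw [← det_waveMatrix]
  refine (det_fin_four (waveMatrix 2 l1 l2 X T)).trans ?_
  have e : ∀ i j : Fin 4, waveMatrix 2 l1 l2 X T i j = column 2 l1 l2 j X T i := fun _ _ => rfl
  have p1 := phi_ne_zero X T l1
  have p2 := phi_ne_zero X T l2
  simp only [e, column_two_zero, column_two_one, column_two_two h1, column_two_three h2]
  simp [show ¬ Even 3 by decide]
  field_simp
  ring

/-- `-Δ'₁₁` for `N = 2`. -/
theorem cramer_two_two (h1 : l1 ≠ 0) (h2 : l2 ≠ 0) (X T : ℂ) :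
    (waveMatrix 2 l1 l2 X T).cramer (column 2 l1 l2 4 X T) 2
      = 2 * l1 * (phi X T l1 ^ 2 / phi X T l2 ^ 2) + 2 * l2 * (phi X T l2 ^ 2 / phi X T l1 ^ 2)
        + 2 * (l1 + l2) + 2 * (l1 - l2) ^ 2 * (slope X T l1 + slope X T l2)
        + 4 * (l1 - l2) ^ 2 * (l1 + l2) * slope X T l1 * slope X T l2 := by
  rw [Matrix.cramer_apply]
  refine (det_fin_four _).trans ?_
  have e : ∀ i j : Fin 4, waveMatrix 2 l1 l2 X T i j = column 2 l1 l2 j X T i := fun _ _ => rfl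
  have p1 := phi_ne_zero X T l1
  have p2 := phi_ne_zero X T l2
  simp only [Matrix.updateCol_apply, e, column_two_zero, column_two_one, column_two_two h1,
    column_two_three h2]
  simp [show ¬ Even 3 by decide, show Even 4 by decide]
  field_simp
  ring

/-- `-Δ'₁₂` for `N = 2`. -/
theorem cramer_two_three (h1 : l1 ≠ 0) (h2 : l2 ≠ 0) (X T : ℂ) :
    (waveMatrix 2 l1 l2 X T).cramer (column 2 l1 l2 4 X T) 3
      = 2 * (l1 - l2) * ((1 - (l1 - l2) * slope X T l2) * phi X T l1 ^ 2
        + (1 + (l1 - l2) * slope X T l1) * phi X T l2 ^ 2) := by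
  rw [Matrix.cramer_apply]
  refine (det_fin_four _).trans ?_
  have e : ∀ i j : Fin 4, waveMatrix 2 l1 l2 X T i j = column 2 l1 l2 j X T i := fun _ _ => rfl
  have p1 := phi_ne_zero X T l1
  have p2 := phi_ne_zero X T l2
  simp only [Matrix.updateCol_apply, e, column_two_zero, column_two_one, column_two_two h1,
    column_two_three h2]
  simp [show Even 4 by decide]
  field_simp
  ring

theorem exp_H {a : ℂ} (ha : a ≠ 0) (X T : ℂ) :
    Complex.exp (H a X T) = phi X T (Complex.I * a) ^ 2 := by
  rw [phi, ← Complex.exp_nat_mul]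
  congr 1
  unfold H
  field_simp
  push_cast
  linear_combination (4 * T * a ^ 2) * Complex.I_sq

theorem slope_I_mul {a : ℂ} (ha : a ≠ 0) (X T : ℂ) :
    slope X T (Complex.I * a) = -(Complex.I * (2 * T * a ^ 2 + X) / (2 * a ^ 2)) := by
  unfold slope
  rw [mul_pow, Complex.I_sq]
  field_simp
  ring

theorem cosh_H_sub (ha : a ≠ 0) (hb : b ≠ 0) (X T : ℂ) :
    2 * Complex.cosh (H a X T - H b X T)
      = phi X T (Complex.I * a) ^ 2 / phi X T (Complex.I * b) ^ 2
        + phi X T (Complex.I * b) ^ 2 / phi X T (Complex.I * a) ^ 2 := by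
  rw [Complex.two_cosh, neg_sub, Complex.exp_sub, Complex.exp_sub, exp_H ha, exp_H hb]

theorem sinh_H_sub (ha : a ≠ 0) (hb : b ≠ 0) (X T : ℂ) :
    2 * Complex.sinh (H a X T - H b X T)
      = phi X T (Complex.I * a) ^ 2 / phi X T (Complex.I * b) ^ 2
        - phi X T (Complex.I * b) ^ 2 / phi X T (Complex.I * a) ^ 2 := by
  rw [Complex.two_sinh, neg_sub, Complex.exp_sub, Complex.exp_sub, exp_H ha, exp_H hb]

theorem twoPositonDenom_eq (ha : a ≠ 0) (hb : b ≠ 0) (X T : ℂ) :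
    twoPositonDenom a b X T
      = a ^ 2 * b ^ 2 * positonW 2 (Complex.I * a) (Complex.I * b) X T := by
  have h := cosh_H_sub ha hb X T
  rw [positonW_two (mul_ne_zero Complex.I_ne_zero ha) (mul_ne_zero Complex.I_ne_zero hb),
    slope_I_mul ha, slope_I_mul hb, ← h, twoPositonDenom, A4]
  field_simp
  linear_combination (-4 * (a - b) ^ 2 * (2 * T * a ^ 2 + X) * (2 * T * b ^ 2 + X)
    * (Complex.I ^ 2 - 1)) * Complex.I_sq

theorem twoPositonQ_numerator (ha : a ≠ 0) (hb : b ≠ 0) (X T : ℂ) :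
    A1 a b X T + A2 a b X T = -(2 * Complex.I) * (a ^ 2 * b ^ 2)
      * (waveMatrix 2 (Complex.I * a) (Complex.I * b) X T).cramer
        (column 2 (Complex.I * a) (Complex.I * b) 4 X T) 3 := by
  rw [cramer_two_three (mul_ne_zero Complex.I_ne_zero ha) (mul_ne_zero Complex.I_ne_zero hb),
    slope_I_mul ha, slope_I_mul hb, A1, A2, exp_H ha, exp_H hb]
  generalize phi X T (Complex.I * a) = p
  generalize phi X T (Complex.I * b) = q
  field_simp
  ring_nf
  simp only [Complex.I_sq, Complex.I_pow_four]
  ring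

theorem twoPositonX_numerator (ha : a ≠ 0) (hb : b ≠ 0) (X T : ℂ) :
    2 * a ^ 2 * b ^ 2 * ((2 * a + 2 * b + X) * Complex.cosh (H a X T - H b X T)
      + (2 * a - 2 * b) * Complex.sinh (H a X T - H b X T)) + A3 a b X T
      = X * twoPositonDenom a b X T - (2 * Complex.I) * (a ^ 2 * b ^ 2)
        * (waveMatrix 2 (Complex.I * a) (Complex.I * b) X T).cramer
          (column 2 (Complex.I * a) (Complex.I * b) 4 X T) 2 := by
  have hc := cosh_H_sub ha hb X T
  have hs := sinh_H_sub ha hb X T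
  rw [cramer_two_two (mul_ne_zero Complex.I_ne_zero ha) (mul_ne_zero Complex.I_ne_zero hb),
    slope_I_mul ha, slope_I_mul hb, twoPositonDenom, A3]
  have hP : phi X T (Complex.I * a) ^ 2 / phi X T (Complex.I * b) ^ 2
    = Complex.cosh (H a X T - H b X T) + Complex.sinh (H a X T - H b X T) := by
    linear_combination (-1 / 2 : ℂ) * hc - (1 / 2 : ℂ) * hs
  have hQ : phi X T (Complex.I * b) ^ 2 / phi X T (Complex.I * a) ^ 2
    = Complex.cosh (H a X T - H b X T) - Complex.sinh (H a X T - H b X T) := by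
    linear_combination (-1 / 2 : ℂ) * hc + (1 / 2 : ℂ) * hs
  have h6 : Complex.I ^ 6 = -1 := by rw [Complex.I_pow_eq_pow_mod]; simp
  rw [hP, hQ]
  generalize Complex.cosh (H a X T - H b X T) = c
  generalize Complex.sinh (H a X T - H b X T) = s
  field_simp
  ring_nf
  simp only [Complex.I_sq, Complex.I_pow_four, h6]
  ring

theorem twoPositon_explicit {a b : ℂ} (ha : a ≠ 0) (hb : b ≠ 0) {X T : ℂ}
    (hD : (X, T) ∈ regularSet 2 (Complex.I * a) (Complex.I * b)) :
    twoPositonDenom a b X T ≠ 0 ∧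
      positonQ 2 (Complex.I * a) (Complex.I * b) X T = twoPositonQ a b X T ∧
      positonX 2 (Complex.I * a) (Complex.I * b) X T = twoPositonX a b X T := by
  have hW : positonW 2 (Complex.I * a) (Complex.I * b) X T ≠ 0 := hD
  have hden := twoPositonDenom_eq ha hb X T
  have hne : twoPositonDenom a b X T ≠ 0 := by
    rw [hden]
    exact mul_ne_zero (mul_ne_zero (pow_ne_zero 2 ha) (pow_ne_zero 2 hb)) hW
  refine ⟨hne, ?_, ?_⟩
  · rw [twoPositonQ, twoPositonQ_numerator ha hb, hden, positonQ_eq one_le_two, coeff,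
      dif_pos (by omega)]
    change 2 * Complex.I * (-((waveMatrix 2 _ _ X T).cramer (column 2 _ _ 4 X T) 3) / _) = _
    field_simp
  · rw [twoPositonX, twoPositonX_numerator ha hb, hden, positonX_eq one_le_two, coeff,
      dif_pos (by omega)]
    change X + 2 * Complex.I * (-((waveMatrix 2 _ _ X T).cramer (column 2 _ _ 4 X T) 2) / _) = _
    field_simp
    ring

end TwoPositon

end RSTPositon

end

theorem mainTheorem2 (N : ℕ) (hN : 1 ≤ N) (l1 l2 : ℂ) (h1 : l1 ≠ 0) (h2 : l2 ≠ 0) :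
    -- the formulas are meaningful: `|W'_N|` does not vanish at the origin
    ((0, 0) ∈ RSTPositon.regularSet N l1 l2) ∧
    -- degenerate limit of the `N`-soliton formulas, through pairwise distinct eigenvalues
    (∀ X T : ℂ, (X, T) ∈ RSTPositon.regularSet N l1 l2 →
      (∀ᶠ Λ in 𝓝[{Λ : Fin (2 * N) → ℂ | Function.Injective Λ}]
          (fun i : Fin (2 * N) => RSTPositon.rowEigenvalue l1 l2 i),
        RSTPositon.solitonW N Λ X T ≠ 0) ∧
      Filter.Tendsto (fun Λ => RSTPositon.solitonQ N Λ X T)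
        (𝓝[{Λ : Fin (2 * N) → ℂ | Function.Injective Λ}]
          (fun i : Fin (2 * N) => RSTPositon.rowEigenvalue l1 l2 i))
        (𝓝 (RSTPositon.positonQ N l1 l2 X T)) ∧
      Filter.Tendsto (fun Λ => RSTPositon.solitonR N Λ X T)
        (𝓝[{Λ : Fin (2 * N) → ℂ | Function.Injective Λ}]
          (fun i : Fin (2 * N) => RSTPositon.rowEigenvalue l1 l2 i))
        (𝓝 (RSTPositon.positonR N l1 l2 X T)) ∧
      Filter.Tendsto (fun Λ => RSTPositon.solitonX N Λ X T)
        (𝓝[{Λ : Fin (2 * N) → ℂ | Function.Injective Λ}]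
          (fun i : Fin (2 * N) => RSTPositon.rowEigenvalue l1 l2 i))
        (𝓝 (RSTPositon.positonX N l1 l2 X T))) ∧
    -- solution in the `(X,T)`-plane
    RSTPositon.SolvesHodographSystem (RSTPositon.regularSet N l1 l2)
      (RSTPositon.positonQ N l1 l2) (RSTPositon.positonR N l1 l2)
      (RSTPositon.positonX N l1 l2) ∧
    -- solution in the `(x,t)`-plane, arbitrary complex eigenvalues, complex variables
    RSTPositon.SolvesRSTParametrically ℂ (RSTPositon.regularSet N l1 l2)
      (RSTPositon.positonQ N l1 l2) (RSTPositon.positonR N l1 l2)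
      (RSTPositon.centredX N l1 l2) ∧
    -- solution in the real `(x,t)`-plane, purely imaginary eigenvalues
    (∀ a b : ℝ, l1 = Complex.I * a → l2 = Complex.I * b →
      (∀ X T : ℝ, (RSTPositon.centredX N l1 l2 X T).im = 0) ∧
      RSTPositon.SolvesRSTParametrically ℝ
        {p : ℝ × ℝ | ((p.1 : ℂ), (p.2 : ℂ)) ∈ RSTPositon.regularSet N l1 l2}
        (fun X T => RSTPositon.positonQ N l1 l2 X T)
        (fun X T => RSTPositon.positonR N l1 l2 X T)
        (fun X T => (RSTPositon.centredX N l1 l2 X T).re)) ∧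
    -- the explicit 2-positon
    (N = 2 → ∀ a b : ℂ, l1 = Complex.I * a → l2 = Complex.I * b →
      ∀ X T : ℂ, (X, T) ∈ RSTPositon.regularSet N l1 l2 →
        RSTPositon.twoPositonDenom a b X T ≠ 0 ∧
        RSTPositon.positonQ N l1 l2 X T = RSTPositon.twoPositonQ a b X T ∧
        RSTPositon.positonX N l1 l2 X T = RSTPositon.twoPositonX a b X T) := by
  refine ⟨RSTPositon.origin_mem_regularSet h1 h2,
    fun X T hD => RSTPositon.degenerate_limit hN h1 h2 hD,
    RSTPositon.solvesHodographSystem_positon hN h1 h2,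
    RSTPositon.solvesRSTParametrically_complex hN h1 h2, ?_, ?_⟩
  · rintro a b rfl rfl
    exact ⟨RSTPositon.centredX_im hN a b, RSTPositon.solvesRSTParametrically_real hN h1 h2⟩
  · rintro rfl a b rfl rfl X T hD
    exact RSTPositon.twoPositon_explicit (right_ne_zero_of_mul h1) (right_ne_zero_of_mul h2) hD
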